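/- **Parking functions.** Let $n,r\ge 0$ be integers. A Dyck path of size $N$ is a lattice path from $(0,0)$ to $(N,N)$ with unit north and east steps staying weakly above $y=x$. Let $\mathcal{WPF}_{n;r}$ be the set of extended word parking functions: Dyck paths of size $n+r$ whose north steps are labeled by non-negative integers, strictly increasing from bottom to top in each column, with exactly $r$ labels equal to $0$ and with the label of the first (bottom) row nonzero. (The zeros mark the $r$ blank valleys.) For $\mathrm{PF}\in\mathcal{WPF}_{n;r}$ let $\ell_i$ be the label of row $i$ (counted from the bottom), $a_i$ the number of full cells between the path and the diagonal in row $i$, and let $d_i$ be the number of $j>i$ such that either $a_i=a_j$ and $\ell_i<\ell_j$, or $a_i=a_j+1$ and $\ell_i>\ell_j$. Put $\mathrm{area}=\sum_i a_i$, $\mathrm{dinv}=\sum_i d_i$, $x^{\mathrm{PF}}=\prod_{i:\,\ell_i\ne 0}x_{\ell_i}$, $\mathrm{Rise}=\{i\ge 2: a_i=a_{i-1}+1\}$ and $\mathrm{Val}=\{i\ge 2: a_i<a_{i-1}\text{, or } a_i=a_{i-1}\text{ and }\ell_i>\ell_{i-1}\}$. For an integer $k$ let $$\mathrm{Rise}_{r;n,k}[X;q,t]=\sum_{\mathrm{PF}\in\mathcal{WPF}_{n;r}}t^{\mathrm{area}}q^{\mathrm{dinv}}x^{\mathrm{PF}}\prod_{i\in\mathrm{Rise}}\Bigl(1+\frac{z}{t^{a_i}}\Bigr)\Big|_{z^{n-k-1}},$$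 $$\mathrm{Val}_{r;n,k}[X;q,t]=\sum_{\mathrm{PF}\in\mathcal{WPF}_{n;r}}t^{\mathrm{area}}q^{\mathrm{dinv}}x^{\mathrm{PF}}\prod_{i\in\mathrm{Val}}\Bigl(1+\frac{z}{q^{d_i+1}}\Bigr)\Big|_{z^{n-k-1}}$$ (a coefficient of a negative power of $z$ is $0$). These are the combinatorial sides of the rise and valley versions of the Extended Delta Conjecture. **Ordered multiset partitions.** For a weak composition $\beta=(\beta_1,\dots,\beta_\ell)$ (a finite sequence of non-negative integers) and an integer $m$, let $\mathcal{OP}_{r;\beta,m}$ be the set of sequences $\pi=B_1/\cdots/B_m$ of $m$ nonempty sets (blocks) whose multiset union is $\{0^r,1^{\beta_1},\dots,\ell^{\beta_\ell}\}$ and whose last block does not contain $0$ (it is empty if $m<0$). Let $B_i^h$ be the $h$th smallest element of $B_i$. * $\mathrm{inv}(\pi)$ is the number of pairs of entries $a>b$ of $\pi$ such that $b$ is the minimum of its block and $a$ is in a block strictly to the left of $b$'s block. * $\mathrm{dinv}(\pi)$ is the number of triples $(h,i,j)$ with $i<j$ and $B_i^h>B_j^h$, plus the number of triples $(h,i,j)$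 with $i<j$ and $B_i^h<B_j^{h+1}$ (the elements compared being required to exist). * $\mathrm{maj}(\pi)=\sum_{i:\,\sigma_i>\sigma_{i+1}}\mathrm{ind}_{i+1}$, where $\sigma$ is the word obtained by writing $B_1,\dots,B_m$ one after the other, each in decreasing order, and $\mathrm{ind}=0^{|B_1|}1^{|B_2|}\cdots(m-1)^{|B_m|}$. * $\mathrm{minimaj}(\pi)$ is the sum of the descent positions $\{i:w_i>w_{i+1}\}$ of the word $w$ built from right to left as follows: write $B_m$ in increasing order; then, for $i=m-1,\dots,1$, write to the left of the existing word first the elements of $B_i$ strictly bigger than the first letter of the existing word, in increasing order, followed by the remaining elements of $B_i$, in increasing order. For each of these statistics let $D^{\mathrm{stat}}_{r;\beta,m}(q)=\sum_{\pi\in\mathcal{OP}_{r;\beta,m}}q^{\mathrm{stat}(\pi)}$. **Theorem.** Let $n,r\ge 0$ and $k$ be integers, let $\beta=(\beta_1,\dots,\beta_\ell)$ be a weak composition of $n$, and let $|_{M_\beta}$ denote the coefficient of the monomial $x_1^{\beta_1}\cdots x_\ell^{\beta_\ell}$. Then $\mathrm{Rise}_{r;n,k}[X;q,t]|_{M_\beta}$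 and $\mathrm{Val}_{r;n,k}[X;q,t]|_{M_\beta}$ are polynomials in $q$ and $t$ with integer coefficients, and $$\mathrm{Rise}_{r;n,k}[X;q,0]|_{M_\beta}=D^{\mathrm{dinv}}_{r;\beta,k+r+1}(q),\qquad \mathrm{Rise}_{r;n,k}[X;0,q]|_{M_\beta}=D^{\mathrm{maj}}_{r;\beta,k+r+1}(q),$$ $$\mathrm{Val}_{r;n,k}[X;q,0]|_{M_\beta}=D^{\mathrm{inv}}_{r;\beta,k+r+1}(q),\qquad \mathrm{Val}_{r;n,k}[X;0,q]|_{M_\beta}=D^{\mathrm{minimaj}}_{r;\beta,k+r+1}(q).$$ -/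

import Mathlib

open scoped Polynomial
open Finset

namespace ExtendedDelta

noncomputable section

/-! ### Dyck paths and extended word parking functions -/

/-- A Dyck path of size `N`: a lattice path from `(0,0)` to `(N,N)` with unit north and east steps
which stays weakly above the line `y = x`. The path is recorded by the `x`-coordinates `col i` of
its north steps, the rows being numbered `0, …, N - 1` from bottom to top: the north step of row `i`
goes from `(col i, i)` to `(col i, i + 1)`. -/
structure DyckPath (N : ℕ) where
  col : Fin N → ℕ
  mono : Monotone col
  above : ∀ i, col i ≤ (i : ℕ)

/-- An extended word parking function of size `n + r` with `r` blank valleys. North steps are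
labeled, strictly increasingly along columns (from bottom to top); a blank valley is given the
label `0`. A label `0` can occur only at the bottom of a column, and the bottom of a column is
either a valley (a row `i` with `a_i ≤ a_{i-1}`) or the first row, so the requirement that only
valleys are blank says that the first row is not labeled `0`. -/
structure ExtWPF (n r : ℕ) extends DyckPath (n + r) where
  label : Fin (n + r) → ℕ
  column_strict : ∀ i j, i < j → col i = col j → label i < label j
  first_ne_zero : ∀ i : Fin (n + r), (i : ℕ) = 0 → label i ≠ 0
  card_blank : #{i | label i = 0} = r

namespace ExtWPF

variable {n r : ℕ}

/-- `a_i`: the number of full cells between the path and the diagonal in row `i`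
(no truncation occurs, by `above`). -/
def rowArea (PF : ExtWPF n r) (i : Fin (n + r)) : ℕ := (i : ℕ) - PF.col i

/-- `d_i`: the number of dinv pairs `(i, j)` with `i < j`. -/
def rowDinv (PF : ExtWPF n r) (i : Fin (n + r)) : ℕ :=
  #{j | i < j ∧
    ((PF.rowArea i = PF.rowArea j ∧ PF.label i < PF.label j) ∨
      (PF.rowArea i = PF.rowArea j + 1 ∧ PF.label j < PF.label i))}

def area (PF : ExtWPF n r) : ℕ := ∑ i, PF.rowArea i

def dinv (PF : ExtWPF n r) : ℕ := ∑ i, PF.rowDinv i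

/-- The double rises: rows `i` with `a_i = a_{i-1} + 1`. -/
def Rise (PF : ExtWPF n r) : Finset (Fin (n + r)) :=
  {i | ∃ j : Fin (n + r), (j : ℕ) + 1 = i ∧ PF.rowArea i = PF.rowArea j + 1}

/-- The contractible valleys: rows `i` with `a_i < a_{i-1}`, or `a_i = a_{i-1}` and
`ℓ_i > ℓ_{i-1}`. -/
def Val (PF : ExtWPF n r) : Finset (Fin (n + r)) :=
  {i | ∃ j : Fin (n + r), (j : ℕ) + 1 = i ∧
    (PF.rowArea i < PF.rowArea j ∨
      (PF.rowArea i = PF.rowArea j ∧ PF.label j < PF.label i))}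

/-- The exponent of the monomial `x^PF = ∏ x_{ℓ_i}`, the product being over the rows that are not
blank (label `0`). -/
def weight (PF : ExtWPF n r) : ℕ →₀ ℕ :=
  ∑ i with PF.label i ≠ 0, Finsupp.single (PF.label i) 1

theorem finite_weight_eq (n r : ℕ) (m : ℕ →₀ ℕ) : {PF : ExtWPF n r | PF.weight = m}.Finite := by
  have hA : (Set.univ.pi fun _ : Fin (n + r) => Set.Iic (n + r)).Finite :=
    Set.Finite.pi fun _ => Set.finite_Iic _
  have hB : (Set.univ.pi fun _ : Fin (n + r) =>
      ((insert 0 m.support : Finset ℕ) : Set ℕ)).Finite :=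
    Set.Finite.pi fun _ => Finset.finite_toSet _
  refine Set.Finite.of_finite_image (f := fun PF : ExtWPF n r => (PF.col, PF.label))
    ((hA.prod hB).subset ?_) ?_
  · rintro _ ⟨PF, hPF, rfl⟩
    refine ⟨fun i _ => (PF.above i).trans i.2.le, fun i _ => ?_⟩
    by_cases h : PF.label i = 0
    · simp [h]
    · have h1 : Finsupp.single (PF.label i) 1 ≤ PF.weight :=
        Finset.single_le_sum (f := fun i => Finsupp.single (PF.label i) 1)
          (fun _ _ => zero_le) (by simp [h])
      have h2 := h1 (PF.label i)
      rw [hPF] at h2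
      simp only [Finsupp.single_eq_same] at h2
      simp only [Finset.coe_insert, Set.mem_insert_iff, Finset.mem_coe, Finsupp.mem_support_iff]
      right
      omega
  · rintro ⟨⟨_, _, _⟩, _, _, _, _⟩ _ ⟨⟨_, _, _⟩, _, _, _, _⟩ _ h
    simp only [Prod.mk.injEq] at h
    obtain ⟨rfl, rfl⟩ := h
    rfl

end ExtWPF

/-! ### The two combinatorial sides -/

/-- The coefficient field `ℚ(q,t)`, as the fraction field of `ℤ[q,t]`. -/
abbrev Kqt : Type := FractionRing (MvPolynomial (Fin 2) ℤ)

def q : Kqt := algebraMap (MvPolynomial (Fin 2) ℤ) Kqt (MvPolynomial.X 0)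

def t : Kqt := algebraMap (MvPolynomial (Fin 2) ℤ) Kqt (MvPolynomial.X 1)

/-- The formal series `∑ f(PF) x^PF` over all extended word parking functions, a power series in
`x_1, x_2, …` (the variable of index `0` does not occur), defined coefficient by coefficient. -/
def genSeries {n r : ℕ} (f : ExtWPF n r → Kqt) : MvPowerSeries ℕ Kqt :=
  fun m => ∑ PF ∈ (ExtWPF.finite_weight_eq n r m).toFinset, f PF

/-- The coefficient of `z^e` in a polynomial in `z`, for an integer `e` (zero if `e < 0`). -/
def zCoeff (e : ℤ) (p : Kqt[X]) : Kqt := if 0 ≤ e then p.coeff e.toNat else 0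

/-- The combinatorial side of the rise version of the Extended Delta Conjecture:
`∑ t^area q^dinv x^PF ∏_{i ∈ Rise} (1 + z / t^{a_i})`, coefficient of `z^{n-k-1}`. -/
def riseSide (r n : ℕ) (k : ℤ) : MvPowerSeries ℕ Kqt :=
  genSeries fun PF : ExtWPF n r => zCoeff ((n : ℤ) - k - 1)
    (Polynomial.C (t ^ PF.area * q ^ PF.dinv) *
      ∏ i ∈ PF.Rise, (1 + Polynomial.C (1 / t ^ PF.rowArea i) * Polynomial.X))

/-- The combinatorial side of the valley version of the Extended Delta Conjecture:
`∑ t^area q^dinv x^PF ∏_{i ∈ Val} (1 + z / q^{d_i + 1})`, coefficient of `z^{n-k-1}`. -/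
def valSide (r n : ℕ) (k : ℤ) : MvPowerSeries ℕ Kqt :=
  genSeries fun PF : ExtWPF n r => zCoeff ((n : ℤ) - k - 1)
    (Polynomial.C (t ^ PF.area * q ^ PF.dinv) *
      ∏ i ∈ PF.Val, (1 + Polynomial.C (1 / q ^ (PF.rowDinv i + 1)) * Polynomial.X))

/-- The exponent of the monomial `x_1^{β_1} ⋯ x_ℓ^{β_ℓ}`. -/
def monoExp {ℓ : ℕ} (β : Fin ℓ → ℕ) : ℕ →₀ ℕ := ∑ i : Fin ℓ, Finsupp.single ((i : ℕ) + 1) (β i)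

/-! ### Extended ordered multiset partitions -/

/-- The multiset `{0^r, 1^{β_1}, …, ℓ^{β_ℓ}}`. -/
def content (r : ℕ) {ℓ : ℕ} (β : Fin ℓ → ℕ) : Multiset ℕ :=
  Multiset.replicate r 0 + ∑ i : Fin ℓ, Multiset.replicate (β i) ((i : ℕ) + 1)

/-- The ordered multiset partitions `B_1 / ⋯ / B_k` of `{0^r, 1^{β_1}, …, ℓ^{β_ℓ}}` into `k`
blocks (nonempty sets) such that `0` is not contained in the last block. -/
def OP (r : ℕ) {ℓ : ℕ} (β : Fin ℓ → ℕ) (k : ℤ) : Set (List (Finset ℕ)) :=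
  {π | (∀ B ∈ π, B.Nonempty) ∧ (π.map Finset.val).sum = content r β ∧
    (∀ B, π.getLast? = some B → 0 ∉ B) ∧ (π.length : ℤ) = k}

theorem OP_finite (r : ℕ) {ℓ : ℕ} (β : Fin ℓ → ℕ) (k : ℤ) : (OP r β k).Finite := by
  refine ((List.finite_length_eq {B // B ∈ (content r β).toFinset.powerset} k.toNat).image
    (List.map Subtype.val)).subset ?_
  rintro π ⟨-, h2, -, h4⟩
  have h : ∀ B ∈ π, B ∈ (content r β).toFinset.powerset := by
    intro B hB
    rw [Finset.mem_powerset]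
    intro x hx
    rw [Multiset.mem_toFinset, ← h2]
    exact Multiset.mem_of_le (List.le_sum_of_mem (List.mem_map_of_mem hB)) hx
  refine ⟨π.attachWith _ h, ?_, by simp⟩
  simp only [Set.mem_ofPred_eq, List.length_attachWith]
  omega

/-! ### The four statistics -/

/-- The number of pairs `a > b` with `b` the minimum of its block and `a` in a block strictly to
the left of the block of `b`. -/
def inv (π : List (Finset ℕ)) : ℕ :=
  ∑ j : Fin π.length, ∑ i : Fin π.length with i < j,
    #{p ∈ π.get i ×ˢ π.get j | p.2 < p.1 ∧ ∀ c ∈ π.get j, p.2 ≤ c}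

/-- The `(h + 1)`-st smallest element of a block, for `h < #B`. -/
def nthSmallest (B : Finset ℕ) (h : ℕ) : ℕ := (B.sort (· ≤ ·)).getD h 0

/-- The number of primary dinvs (`i < j` and `B_i^h > B_j^h`) plus the number of secondary dinvs
(`i < j` and `B_i^h < B_j^{h+1}`), where the elements compared have to exist. -/
def opDinv (π : List (Finset ℕ)) : ℕ :=
  ∑ j : Fin π.length, ∑ i : Fin π.length with i < j,
    (#{h ∈ range #(π.get i) | h < #(π.get j) ∧
        nthSmallest (π.get j) h < nthSmallest (π.get i) h} +
      #{h ∈ range #(π.get i) | h + 1 < #(π.get j) ∧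
        nthSmallest (π.get i) h < nthSmallest (π.get j) (h + 1)})

/-- The word obtained by writing each block in decreasing order. -/
def sigma (π : List (Finset ℕ)) : List ℕ := π.flatMap fun B => B.sort (· ≥ ·)

/-- The index word `0^{|B_1|} 1^{|B_2|} ⋯ (k-1)^{|B_k|}`. -/
def ind (π : List (Finset ℕ)) : List ℕ :=
  (π.mapIdx fun i B => List.replicate #B i).flatten

/-- The sum of the letters `ind_{i+1}` over the descents `i` of the word `sigma π`. -/
def opMaj (π : List (Finset ℕ)) : ℕ :=
  ∑ i ∈ range ((sigma π).length - 1),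
    if (sigma π).getD (i + 1) 0 < (sigma π).getD i 0 then (ind π).getD (i + 1) 0 else 0

/-- The word built from right to left, each block being written with its elements that are strictly
bigger than the first letter of the next (already written) block first, in increasing order,
followed by its remaining elements in increasing order. -/
def miniword : List (Finset ℕ) → List ℕ
  | [] => []
  | B :: π =>
    match miniword π with
    | [] => B.sort (· ≤ ·)
    | a :: w =>
      ({x ∈ B | a < x} : Finset ℕ).sort (· ≤ ·) ++ ({x ∈ B | x ≤ a} : Finset ℕ).sort (· ≤ ·) ++
        a :: w

/-- The major index of a word: the sum of its descent positions, which are numbered from `1`. -/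
def wordMaj (w : List ℕ) : ℕ :=
  ∑ i ∈ range (w.length - 1), if w.getD (i + 1) 0 < w.getD i 0 then i + 1 else 0

def minimaj (π : List (Finset ℕ)) : ℕ := wordMaj (miniword π)

/-- The generating polynomial of a statistic over the ordered multiset partitions `OP r β k`. -/
def genPoly (r : ℕ) {ℓ : ℕ} (β : Fin ℓ → ℕ) (k : ℤ) (stat : List (Finset ℕ) → ℕ) : ℤ[X] :=
  ∑ π ∈ (OP_finite r β k).toFinset, Polynomial.X ^ stat π

end

end ExtendedDelta

/-!
Expanding the product over the rises (valleys) turns `Rise` (`Val`) into a sum over parking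
functions in which `n - k - 1` double rises (contractible valleys) are *marked*, so that `k + r + 1`
rows stay unmarked. A mark on a double rise `i` removes `a_i` from the area, which leaves the area
of the unmarked rows; a mark on a contractible valley `i` removes `d_i + 1` from the dinv, which
leaves the contribution of the unmarked rows minus the number of marks. The latter is nonnegative
because every marked valley is counted by the `d_j` of some unmarked row `j`: hence the coefficients
are polynomials.

Setting `t = 0` or `q = 0` keeps the marked parking functions for which one statistic vanishes, and
these correspond to ordered multiset partitions, one block for each unmarked row. In three of the
four cases the blocks, each in decreasing order, spell the labels from top to bottom, all letters
except the block minima being marked, and this marked word determines the areas row by row. For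
`minimaj` one instead starts from an auxiliary bottom row with a label larger than all others and
inserts the blocks from right to left, each as low as possible above the topmost unmarked row; the
areas of the inserted rows are then forced.
-/

namespace ExtendedDelta

section Lists

variable {α β γ : Type*}

/-- The list `l` is *linked* by `R` above `P` if consecutive entries are related by `R` and the last
entry satisfies `P`. With the rows of a parking function listed from top to bottom, `R` is the
condition on adjacent rows and `P` the condition on the bottom row. -/
def Linked (R : α → α → Prop) (P : α → Prop) (l : List α) : Prop :=
  l.IsChain R ∧ ∀ x ∈ l.getLast?, P x

section Linked

variable {R : α → α → Prop} {P : α → Prop}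

@[simp] theorem linked_nil : Linked R P [] := by simp [Linked]

@[simp] theorem linked_singleton {x : α} : Linked R P [x] ↔ P x := by simp [Linked]

@[simp] theorem linked_cons_cons {x y : α} {l : List α} :
    Linked R P (y :: x :: l) ↔ R y x ∧ Linked R P (x :: l) := by
  simp [Linked, and_assoc]

theorem linked_append_singleton {l : List α} {s : α} :
    Linked R P (l ++ [s]) ↔ Linked R (R · s) l ∧ P s := by
  induction l with
  | nil => simp
  | cons y l ih => cases l <;> simp_all [and_assoc]

theorem linked_cons {y : α} {l : List α} :
    Linked R P (y :: l) ↔ (∀ x ∈ l.head?, R y x) ∧ (l = [] → P y) ∧ Linked R P l := by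
  cases l <;> simp

theorem Linked.tail {y : α} {l : List α} (h : Linked R P (y :: l)) : Linked R P l :=
  (linked_cons.1 h).2.2

theorem Linked.imp {S : α → α → Prop} {Q : α → Prop} {l : List α} (h : Linked R P l)
    (hR : ∀ y x, R y x → S y x) (hP : ∀ x, P x → Q x) : Linked S Q l :=
  ⟨h.1.imp hR, fun x hx => hP x (h.2 x hx)⟩

theorem linked_map {f : β → α} {l : List β} :
    Linked R P (l.map f) ↔ Linked (fun y x => R (f y) (f x)) (fun x => P (f x)) l := by
  induction l with
  | nil => simp
  | cons y l ih => cases l <;> simp_all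

theorem linked_reverse_ofFn {N : ℕ} (f : Fin N → α) :
    Linked R P (List.ofFn f).reverse ↔
      (∀ i j : Fin N, (j : ℕ) + 1 = i → R (f i) (f j)) ∧ ∀ i : Fin N, (i : ℕ) = 0 → P (f i) := by
  rw [Linked, List.isChain_reverse, List.isChain_ofFn, List.getLast?_reverse]
  refine and_congr ⟨fun h i j hij => ?_, fun h i hi => h _ _ rfl⟩ ?_
  · obtain ⟨i, hi⟩ := i
    obtain ⟨j, hj⟩ := j
    obtain rfl : j + 1 = i := hij
    exact h j hi
  · cases N with
    | zero => simp
    | succ N =>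
      rw [List.ofFn_succ]
      simp only [List.head?_cons, Option.mem_some_iff, forall_eq']
      refine ⟨fun h i hi => ?_, fun h => h 0 rfl⟩
      rwa [show i = 0 from Fin.ext hi]

end Linked

section PairSum

/-- The sum of `g x y` over all pairs of entries `x`, `y` of a list, with `x` before `y`. -/
def pairSum (g : α → α → ℕ) : List α → ℕ
  | [] => 0
  | x :: l => (l.map (g x)).sum + pairSum g l

@[simp] theorem pairSum_nil (g : α → α → ℕ) : pairSum g [] = 0 := rfl

@[simp] theorem pairSum_cons (g : α → α → ℕ) (x : α) (l : List α) :
    pairSum g (x :: l) = (l.map (g x)).sum + pairSum g l := rfl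

/-- The sum of `g x y` over the entries `x` of `A` and `y` of `B`. -/
def crossSum (g : α → α → ℕ) (A B : List α) : ℕ := (A.map fun x => (B.map (g x)).sum).sum

@[simp] theorem crossSum_nil_left (g : α → α → ℕ) (B : List α) : crossSum g [] B = 0 := rfl

@[simp] theorem crossSum_cons_left (g : α → α → ℕ) (x : α) (A B : List α) :
    crossSum g (x :: A) B = (B.map (g x)).sum + crossSum g A B := rfl

@[simp] theorem crossSum_nil_right (g : α → α → ℕ) (A : List α) : crossSum g A [] = 0 := by
  induction A <;> simp_all

theorem crossSum_append_right (g : α → α → ℕ) (A B D : List α) :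
    crossSum g A (B ++ D) = crossSum g A B + crossSum g A D := by
  simp [crossSum, List.sum_map_add]

theorem crossSum_cons_right (g : α → α → ℕ) (x : α) (A B : List α) :
    crossSum g A (x :: B) = (A.map fun y => g y x).sum + crossSum g A B := by
  simp [crossSum, List.sum_map_add]

theorem crossSum_flatMap_right (g : γ → γ → ℕ) (A : List γ) (f : α → List γ) (l : List α) :
    crossSum g A (l.flatMap f) = (l.map fun x => crossSum g A (f x)).sum := by
  induction l with
  | nil => simp
  | cons x l ih => simp [crossSum_append_right, ih]

theorem pairSum_append (g : α → α → ℕ) (A B : List α) :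
    pairSum g (A ++ B) = pairSum g A + pairSum g B + crossSum g A B := by
  induction A with
  | nil => simp
  | cons x A ih =>
    simp only [List.cons_append, pairSum_cons, List.map_append, List.sum_append, ih,
      crossSum_cons_left]
    omega

theorem pairSum_reverse (g : α → α → ℕ) (l : List α) :
    pairSum g l.reverse = pairSum (fun x y => g y x) l := by
  induction l with
  | nil => rfl
  | cons x l ih =>
    simp [pairSum_append, crossSum_cons_right, ih, List.map_reverse, List.sum_reverse, add_comm]

theorem pairSum_flatMap (g : γ → γ → ℕ) (f : α → List γ) (l : List α) :
    pairSum g (l.flatMap f) = pairSum (fun x y => crossSum g (f x) (f y)) l +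
      (l.map fun x => pairSum g (f x)).sum := by
  induction l with
  | nil => rfl
  | cons x l ih =>
    simp only [List.flatMap_cons, pairSum_append, ih, crossSum_flatMap_right, pairSum_cons,
      List.map_cons, List.sum_cons]
    omega

theorem pairSum_ofFn {N : ℕ} (g : α → α → ℕ) (f : Fin N → α) :
    pairSum g (List.ofFn f) = ∑ i, ∑ j with i < j, g (f i) (f j) := by
  induction N with
  | zero => simp
  | succ N ih =>
    rw [List.ofFn_succ, pairSum_cons, ih, Fin.sum_univ_succ]
    simp [Finset.sum_filter, Fin.sum_univ_succ, List.sum_ofFn, List.map_ofFn]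

theorem pairSum_eq_sum_get (g : α → α → ℕ) (l : List α) :
    pairSum g l = ∑ j : Fin l.length, ∑ i : Fin l.length with i < j, g (l.get i) (l.get j) := by
  conv_lhs => rw [← List.ofFn_get l, pairSum_ofFn]
  simp only [Finset.sum_filter]
  exact Finset.sum_comm

end PairSum

theorem strictMono_of_lt_succ [Preorder α] {N : ℕ} {f : Fin N → α}
    (h : ∀ i j : Fin N, (i : ℕ) + 1 = j → f i < f j) : StrictMono f := by
  cases N with
  | zero => exact fun i => i.elim0
  | succ N => exact Fin.strictMono_iff_lt_succ.2 fun i => h _ _ (by simp)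

end Lists

/-! ### Rows of marked parking functions -/

/-- A row of a labeled Dyck path with some rows marked. -/
@[ext] structure Row where
  area : ℕ
  label : ℕ
  mark : Bool

namespace Row

/-- `y` may be the row directly above `x`. If `y` has area `x.area + 1`, then it lies in the column
of `x`, where labels increase. -/
def Step (y x : Row) : Prop := y.area ≤ x.area + 1 ∧ (y.area = x.area + 1 → x.label < y.label)

/-- The row `y`, if directly above `x`, is a double rise. -/
def IsRise (y x : Row) : Prop := y.area = x.area + 1

/-- The row `y`, if directly above `x`, is a contractible valley. -/
def IsVal (y x : Row) : Prop := y.area < x.area ∨ (y.area = x.area ∧ x.label < y.label)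

/-- `(x, y)` is a dinv pair, if `x` is below `y`. -/
def Attacks (x y : Row) : Prop :=
  (x.area = y.area ∧ x.label < y.label) ∨ (x.area = y.area + 1 ∧ y.label < x.label)

instance : DecidableRel IsVal := fun x y => by unfold IsVal; infer_instance

instance : DecidableRel Attacks := fun x y => by unfold Attacks; infer_instance

/-- The condition on the bottom row of a labeled Dyck path (a blank bottom row being allowed). -/
def IsGround (x : Row) : Prop := x.area = 0 ∧ x.mark = false

/-- The condition on the bottom row of an extended word parking function. -/
def IsBottom (x : Row) : Prop := x.IsGround ∧ x.label ≠ 0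

theorem attacks_iff {x y : Row} : x.Attacks y ↔ y.IsVal x ∧ x.Step y := by
  simp only [IsVal, Attacks, Step]
  omega

theorem not_isVal_trans {x y z : Row} (hxy : ¬ x.IsVal y) (hyz : ¬ y.IsVal z) : ¬ x.IsVal z := by
  simp only [IsVal] at *
  omega

end Row

/-- The condition on two consecutive rows, `y` above `x`, of a parking function whose marked rows
are subject to `M`. -/
def MarkedStep (M : Row → Row → Prop) (y x : Row) : Prop := y.Step x ∧ (y.mark = true → M y x)

section Statistics

/-- The sum of the areas of the rows. -/
def totalArea (V : List Row) : ℕ := (V.map Row.area).sum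

/-- The sum of the areas of the unmarked rows, which is the exponent of `t` on the rise side. -/
def unmarkedArea (V : List Row) : ℕ := (V.map fun x => if x.mark then 0 else x.area).sum

/-- The number of dinv pairs, the rows being listed from top to bottom. -/
def totalDinv (V : List Row) : ℕ := pairSum (fun y x => if x.Attacks y then 1 else 0) V

/-- The number of dinv pairs whose lower row is unmarked, the rows being listed from top to bottom.
On the valley side the exponent of `q` is this number minus the number of marks. -/
def unmarkedDinv (V : List Row) : ℕ :=
  pairSum (fun y x => if x.mark = false ∧ x.Attacks y then 1 else 0) V

/-- The number of marked rows. -/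
def numMarks (V : List Row) : ℕ := V.countP fun x => x.mark

/-- The number of unmarked rows of `V` that would form a dinv pair with a row `y` on top of `V`. -/
def attackers (y : Row) (V : List Row) : ℕ :=
  (V.map fun x => if x.mark = false ∧ x.Attacks y then 1 else 0).sum

@[simp] theorem totalArea_cons (x : Row) (V : List Row) :
    totalArea (x :: V) = x.area + totalArea V := by simp [totalArea]

@[simp] theorem unmarkedArea_cons (x : Row) (V : List Row) :
    unmarkedArea (x :: V) = (if x.mark then 0 else x.area) + unmarkedArea V := by
  simp [unmarkedArea]

@[simp] theorem unmarkedDinv_cons (y : Row) (V : List Row) :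
    unmarkedDinv (y :: V) = attackers y V + unmarkedDinv V := rfl

@[simp] theorem numMarks_cons (x : Row) (V : List Row) :
    numMarks (x :: V) = numMarks V + if x.mark then 1 else 0 := by
  simp [numMarks, List.countP_cons]

theorem attackers_eq_zero {y : Row} {V : List Row} :
    attackers y V = 0 ↔ ∀ x ∈ V, x.mark = false → ¬ x.Attacks y := by
  simp [attackers, List.sum_eq_zero_iff]

end Statistics

/-- The lowest row preceding `e` in the order of valleys is unmarked and attacks `e`. -/
theorem exists_unmarked_attacks {V : List Row} (hV : Linked (MarkedStep Row.IsVal) Row.IsGround V)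
    {e : Row} (h : ∃ x ∈ V, e.IsVal x) : ∃ y ∈ V, y.mark = false ∧ y.Attacks e := by
  induction V with
  | nil => simp at h
  | cons y V ih =>
    by_cases hbelow : ∃ z ∈ V, e.IsVal z
    · obtain ⟨w, hw, hw'⟩ := ih hV.tail hbelow
      exact ⟨w, List.mem_cons_of_mem y hw, hw'⟩
    push Not at hbelow
    have hey : e.IsVal y := by
      obtain ⟨x, hx, hex⟩ := h
      rcases List.mem_cons.1 hx with rfl | hx
      exacts [hex, absurd hex (hbelow x hx)]
    refine ⟨y, by simp, ?_⟩
    cases V with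
    | nil =>
      obtain ⟨harea, hmark⟩ := linked_singleton.1 hV
      refine ⟨hmark, ?_⟩
      simp only [Row.IsVal, Row.Attacks] at *
      omega
    | cons z V =>
      obtain ⟨hstep, hval⟩ := (linked_cons_cons.1 hV).1
      have hez : ¬ e.IsVal z := hbelow z (by simp)
      constructor
      · by_contra hmark
        have hyz : y.IsVal z := hval (by simpa using hmark)
        simp only [Row.IsVal] at *
        omega
      · simp only [Row.IsVal, Row.Attacks, Row.Step] at *
        omega

theorem attackers_pos {V : List Row} (hV : Linked (MarkedStep Row.IsVal) Row.IsGround V)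
    {e : Row} (h : ∃ x ∈ V, e.IsVal x) : 0 < attackers e V := by
  obtain ⟨y, hyV, hmark, hatt⟩ := exists_unmarked_attacks hV h
  exact Nat.pos_of_ne_zero fun h0 => attackers_eq_zero.1 h0 y hyV hmark hatt

theorem ite_mark_le_attackers {y : Row} {V : List Row}
    (hV : Linked (MarkedStep Row.IsVal) Row.IsGround (y :: V)) :
    (if y.mark then 1 else 0) ≤ attackers y V := by
  split_ifs with hy
  · cases V with
    | nil => simp [(linked_singleton.1 hV).2] at hy
    | cons x V => exact attackers_pos hV.tail ⟨x, by simp, (linked_cons_cons.1 hV).1.2 hy⟩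
  · exact Nat.zero_le _

theorem numMarks_le_unmarkedDinv {V : List Row}
    (hV : Linked (MarkedStep Row.IsVal) Row.IsGround V) : numMarks V ≤ unmarkedDinv V := by
  induction V with
  | nil => simp [numMarks]
  | cons y V ih =>
    rw [numMarks_cons, unmarkedDinv_cons, add_comm]
    exact add_le_add (ite_mark_le_attackers hV) (ih hV.tail)

/-- The lists of rows, from top to bottom, of the parking functions with given content, with `m`
unmarked rows and with marked rows subject to `M`. -/
def markedPF (M : Row → Row → Prop) (r : ℕ) {ℓ : ℕ} (β : Fin ℓ → ℕ) (m : ℤ) : Set (List Row) :=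
  {V | Linked (MarkedStep M) Row.IsBottom V ∧
    (V.map Row.label : Multiset ℕ) = content r β ∧ ((V.length : ℤ) - numMarks V) = m}

theorem card_content (r : ℕ) {ℓ : ℕ} (β : Fin ℓ → ℕ) : (content r β).card = r + ∑ i, β i := by
  simp [content]

theorem count_content (r : ℕ) {ℓ : ℕ} (β : Fin ℓ → ℕ) (x : ℕ) :
    (content r β).count x = (if x = 0 then r else 0) + monoExp β x := by
  rw [content, Multiset.count_add, Multiset.count_replicate, monoExp, Multiset.count_sum',
    Finsupp.finsetSum_apply]
  congr 1
  · simp [eq_comm]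
  · refine Finset.sum_congr rfl fun i _ => ?_
    simp [Multiset.count_replicate, Finsupp.single_apply]

theorem monoExp_zero {ℓ : ℕ} (β : Fin ℓ → ℕ) : monoExp β 0 = 0 := by
  simp [monoExp, Finsupp.finsetSum_apply]

theorem countP_ofFn {α : Type*} {N : ℕ} (f : Fin N → α) (p : α → Bool) :
    (List.ofFn f).countP p = #{i | p (f i)} := by
  induction N with
  | zero => simp
  | succ N ih =>
    rw [List.ofFn_succ, List.countP_cons, ih, Fin.card_filter_univ_succ']
    simp [add_comm]

theorem exists_ofFn_reverse_eq {α : Type*} {N : ℕ} {l : List α} (hl : l.length = N) :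
    ∃ f : Fin N → α, (List.ofFn f).reverse = l := by
  refine ⟨fun i => l.reverse.get (i.cast (by simp [hl])), ?_⟩
  rw [List.reverse_eq_iff]
  exact List.ext_getElem (by simp [hl]) (by simp)

section Rows

variable {n r : ℕ}

/-- The `i`-th row of a parking function with marked rows `S`. -/
def ExtWPF.row (PF : ExtWPF n r) (S : Finset (Fin (n + r))) (i : Fin (n + r)) : Row :=
  ⟨PF.rowArea i, PF.label i, decide (i ∈ S)⟩

/-- The rows of a parking function with marked rows `S`, from top to bottom. -/
def ExtWPF.rows (PF : ExtWPF n r) (S : Finset (Fin (n + r))) : List Row :=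
  (List.ofFn (PF.row S)).reverse

theorem pairSum_rows (PF : ExtWPF n r) (S : Finset (Fin (n + r))) (g : Row → Row → ℕ) :
    pairSum g (PF.rows S) = ∑ i, ∑ j with i < j, g (PF.row S j) (PF.row S i) := by
  rw [ExtWPF.rows, pairSum_reverse, pairSum_ofFn]

theorem sum_map_rows (PF : ExtWPF n r) (S : Finset (Fin (n + r))) (g : Row → ℕ) :
    ((PF.rows S).map g).sum = ∑ i, g (PF.row S i) := by
  rw [ExtWPF.rows, List.map_reverse, List.sum_reverse, List.map_ofFn, List.sum_ofFn]
  rfl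

theorem countP_rows (PF : ExtWPF n r) (S : Finset (Fin (n + r))) (p : Row → Bool) :
    (PF.rows S).countP p = #{i | p (PF.row S i)} := by
  rw [ExtWPF.rows, List.countP_reverse, countP_ofFn]

theorem length_rows (PF : ExtWPF n r) (S : Finset (Fin (n + r))) :
    (PF.rows S).length = n + r := by simp [ExtWPF.rows]

theorem totalArea_rows (PF : ExtWPF n r) (S : Finset (Fin (n + r))) :
    totalArea (PF.rows S) = PF.area := sum_map_rows PF S _

theorem unmarkedArea_rows (PF : ExtWPF n r) (S : Finset (Fin (n + r))) :
    unmarkedArea (PF.rows S) + ∑ i ∈ S, PF.rowArea i = PF.area := by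
  rw [unmarkedArea, sum_map_rows, ExtWPF.area,
    ← Finset.sum_filter_add_sum_filter_not univ (· ∈ S) PF.rowArea, add_comm]
  congr 1
  · simp
  · simp [ExtWPF.row, Finset.sum_filter]

theorem numMarks_rows (PF : ExtWPF n r) (S : Finset (Fin (n + r))) :
    numMarks (PF.rows S) = #S := by
  rw [numMarks, countP_rows]
  simp [ExtWPF.row]

theorem rowDinv_eq (PF : ExtWPF n r) (S : Finset (Fin (n + r))) (i : Fin (n + r)) :
    PF.rowDinv i = ∑ j with i < j, if (PF.row S i).Attacks (PF.row S j) then 1 else 0 := by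
  rw [ExtWPF.rowDinv, ← Finset.filter_filter, Finset.card_filter]
  refine Finset.sum_congr rfl fun j _ => ?_
  exact if_congr Iff.rfl rfl rfl

theorem totalDinv_rows (PF : ExtWPF n r) (S : Finset (Fin (n + r))) :
    totalDinv (PF.rows S) = PF.dinv := by
  rw [totalDinv, pairSum_rows]
  exact Finset.sum_congr rfl fun i _ => (rowDinv_eq PF S i).symm

theorem unmarkedDinv_rows (PF : ExtWPF n r) (S : Finset (Fin (n + r))) :
    unmarkedDinv (PF.rows S) + ∑ i ∈ S, PF.rowDinv i = PF.dinv := by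
  rw [unmarkedDinv, pairSum_rows, ExtWPF.dinv,
    ← Finset.sum_filter_add_sum_filter_not univ (· ∈ S) PF.rowDinv, add_comm]
  congr 1
  · simp
  · rw [Finset.sum_filter]
    refine Finset.sum_congr rfl fun i _ => ?_
    by_cases hi : i ∈ S
    · simp [ExtWPF.row, hi]
    · rw [if_pos hi, rowDinv_eq PF S i]
      simp [ExtWPF.row, hi]

theorem weight_apply (PF : ExtWPF n r) (x : ℕ) :
    PF.weight x = if x = 0 then 0 else #{i | PF.label i = x} := by
  rw [ExtWPF.weight, Finsupp.finsetSum_apply, Finset.sum_filter, Finset.card_filter]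
  split_ifs with hx
  · subst hx
    simp +contextual
  · refine Finset.sum_congr rfl fun i _ => ?_
    by_cases h : PF.label i = x <;> simp [h, hx]

theorem labels_rows_eq_content_iff {ℓ : ℕ} (β : Fin ℓ → ℕ) (PF : ExtWPF n r)
    (S : Finset (Fin (n + r))) :
    ((PF.rows S).map Row.label : Multiset ℕ) = content r β ↔ PF.weight = monoExp β := by
  rw [Multiset.ext, DFunLike.ext_iff]
  refine forall_congr' fun x => ?_
  have hcount : ((PF.rows S).map Row.label).count x = #{i | PF.label i = x} := by
    rw [List.count_eq_countP, List.countP_map, countP_rows]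
    simp [ExtWPF.row]
  rw [Multiset.coe_count, hcount, count_content, weight_apply]
  rcases eq_or_ne x 0 with rfl | hx
  · simp [PF.card_blank, monoExp_zero]
  · simp [hx]

theorem rowArea_add_col (PF : ExtWPF n r) (i : Fin (n + r)) : PF.rowArea i + PF.col i = i :=
  Nat.sub_add_cancel (PF.above i)

theorem linked_rows {M : Row → Row → Prop} (PF : ExtWPF n r) {S : Finset (Fin (n + r))}
    (hS : ∀ i ∈ S, ∃ j : Fin (n + r), (j : ℕ) + 1 = i ∧ M (PF.row S i) (PF.row S j)) :
    Linked (MarkedStep M) Row.IsBottom (PF.rows S) := by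
  refine (linked_reverse_ofFn _).2 ⟨fun i j hij => ⟨?_, fun hmark => ?_⟩,
    fun i hi => ⟨⟨?_, ?_⟩, PF.first_ne_zero i hi⟩⟩
  · have hi := rowArea_add_col PF i
    have hj := rowArea_add_col PF j
    have hcol : PF.col j ≤ PF.col i := PF.mono (Fin.le_def.2 (by omega))
    refine ⟨by simp only [ExtWPF.row]; omega, fun harea => ?_⟩
    simp only [ExtWPF.row] at harea
    exact PF.column_strict j i (Fin.lt_def.2 (by omega)) (by omega)
  · obtain ⟨j', hj', hM⟩ := hS i (by simpa [ExtWPF.row] using hmark)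
    rwa [show j = j' from Fin.ext (by omega)]
  · have := rowArea_add_col PF i
    simp only [ExtWPF.row]
    omega
  · by_contra hmark
    obtain ⟨j, hj, -⟩ := hS i (by simpa [ExtWPF.row] using hmark)
    omega

theorem rows_injective :
    Function.Injective fun p : ExtWPF n r × Finset (Fin (n + r)) => p.1.rows p.2 := by
  rintro ⟨PF, S⟩ ⟨PF', S'⟩ h
  have hrow : PF.row S = PF'.row S' := List.ofFn_injective (List.reverse_injective h)
  have hcol : PF.col = PF'.col := by
    funext i
    have harea : PF.rowArea i = PF'.rowArea i := congrArg Row.area (congrFun hrow i)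
    have hi := rowArea_add_col PF i
    have hi' := rowArea_add_col PF' i
    omega
  have hlabel : PF.label = PF'.label := funext fun i => congrArg Row.label (congrFun hrow i)
  have hmark : S = S' := by
    ext i
    simpa [ExtWPF.row] using congrArg Row.mark (congrFun hrow i)
  obtain ⟨⟨_, _, _⟩, _, _, _, _⟩ := PF
  obtain ⟨⟨_, _, _⟩, _, _, _, _⟩ := PF'
  simp only at hcol hlabel
  subst hcol hlabel hmark
  rfl

section Construction

variable {N : ℕ} {f : Fin N → Row}

theorem area_le_index (hstep : ∀ i j : Fin N, (j : ℕ) + 1 = i → (f i).Step (f j))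
    (hbot : ∀ i : Fin N, (i : ℕ) = 0 → (f i).area = 0) (i : Fin N) : (f i).area ≤ i := by
  obtain ⟨k, hk⟩ := i
  induction k with
  | zero => exact (hbot ⟨0, hk⟩ rfl).le
  | succ k ih => exact (hstep ⟨k + 1, hk⟩ ⟨k, by omega⟩ rfl).1.trans (by simpa using ih (by omega))

/-- Both defining conditions of a labeled Dyck path, monotone columns and labels increasing along
each column, say that the pairs (column, label) increase lexicographically. -/
theorem strictMono_toLex_col_label
    (hstep : ∀ i j : Fin N, (j : ℕ) + 1 = i → (f i).Step (f j))
    (hbot : ∀ i : Fin N, (i : ℕ) = 0 → (f i).area = 0) :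
    StrictMono fun i : Fin N => toLex ((i : ℕ) - (f i).area, (f i).label) := by
  refine strictMono_of_lt_succ fun i j hij => Prod.Lex.toLex_lt_toLex.2 ?_
  have hi := area_le_index hstep hbot i
  have hj := area_le_index hstep hbot j
  have hji := hstep j i hij
  simp only [Row.Step] at hji ⊢
  omega

end Construction

theorem exists_row_eq {f : Fin (n + r) → Row}
    (hstep : ∀ i j : Fin (n + r), (j : ℕ) + 1 = i → (f i).Step (f j))
    (hbot : ∀ i : Fin (n + r), (i : ℕ) = 0 → (f i).area = 0 ∧ (f i).label ≠ 0)
    (hblank : #{i | (f i).label = 0} = r) :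
    ∃ PF : ExtWPF n r, PF.row {i | (f i).mark = true} = f := by
  have hlex := strictMono_toLex_col_label hstep fun i hi => (hbot i hi).1
  refine ⟨{
    col := fun i => i - (f i).area
    mono := fun i j hij => (Prod.Lex.toLex_le_toLex'.1 (hlex.monotone hij)).1
    above := fun i => Nat.sub_le _ _
    label := fun i => (f i).label
    column_strict := fun i j hij => (Prod.Lex.toLex_lt_toLex'.1 (hlex hij)).2
    first_ne_zero := fun i hi => (hbot i hi).2
    card_blank := hblank }, ?_⟩
  funext i
  have harea := area_le_index hstep (fun i hi => (hbot i hi).1) i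
  refine Row.ext ?_ rfl (by simp [ExtWPF.row])
  simp only [ExtWPF.row, ExtWPF.rowArea]
  omega

theorem exists_rows_eq {M : Row → Row → Prop} {ℓ : ℕ} {β : Fin ℓ → ℕ} (hβ : ∑ i, β i = n)
    {m : ℤ} {V : List Row} (hV : V ∈ markedPF M r β m) :
    ∃ (PF : ExtWPF n r) (S : Finset (Fin (n + r))), PF.rows S = V := by
  obtain ⟨hlinked, hlabels, -⟩ := hV
  have hlen : V.length = n + r := by
    simpa [card_content, hβ, add_comm] using congrArg Multiset.card hlabels
  obtain ⟨f, rfl⟩ := exists_ofFn_reverse_eq hlen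
  obtain ⟨hstep, hbot⟩ := (linked_reverse_ofFn f).1 hlinked
  have hblank : #{i | (f i).label = 0} = r := by
    have hcount := congrArg (Multiset.count 0) hlabels
    rw [count_content, monoExp_zero, Multiset.coe_count, List.count_eq_countP, List.countP_map,
      List.countP_reverse, countP_ofFn] at hcount
    simpa using hcount
  obtain ⟨PF, hPF⟩ := exists_row_eq (fun i j hij => (hstep i j hij).1)
    (fun i hi => ⟨(hbot i hi).1.1, (hbot i hi).2⟩) hblank
  exact ⟨PF, _, by rw [ExtWPF.rows, hPF]⟩

theorem bijOn_rows {M : Row → Row → Prop} {R : ExtWPF n r → Finset (Fin (n + r))}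
    (hR : ∀ PF S i, i ∈ R PF ↔
      ∃ j : Fin (n + r), (j : ℕ) + 1 = i ∧ M (PF.row S i) (PF.row S j))
    {ℓ : ℕ} {β : Fin ℓ → ℕ} (hβ : ∑ i, β i = n) (k : ℤ) :
    Set.BijOn (fun p : ExtWPF n r × Finset (Fin (n + r)) => p.1.rows p.2)
      {p | p.1.weight = monoExp β ∧ p.2 ⊆ R p.1 ∧ (#p.2 : ℤ) = n - k - 1}
      (markedPF M r β (k + r + 1)) := by
  have hcard : ∀ (PF : ExtWPF n r) S, ((PF.rows S).length : ℤ) - numMarks (PF.rows S) = k + r + 1 ↔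
      (#S : ℤ) = n - k - 1 := fun PF S => by
    rw [length_rows, numMarks_rows]
    omega
  refine ⟨?_, rows_injective.injOn, fun V hV => ?_⟩
  · rintro ⟨PF, S⟩ ⟨hweight, hS, hm⟩
    exact ⟨linked_rows PF fun i hi => (hR PF S i).1 (hS hi),
      (labels_rows_eq_content_iff β PF S).2 hweight, (hcard PF S).2 hm⟩
  · obtain ⟨PF, S, rfl⟩ := exists_rows_eq hβ hV
    obtain ⟨hlinked, hlabels, hm⟩ := hV
    obtain ⟨hstep, hbot⟩ := (linked_reverse_ofFn _).1 hlinked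
    refine ⟨(PF, S), ⟨(labels_rows_eq_content_iff β PF S).1 hlabels, fun i hi => ?_,
      (hcard PF S).1 hm⟩, rfl⟩
    have hmark : (PF.row S i).mark = true := by simpa [ExtWPF.row] using hi
    have hi0 : (i : ℕ) ≠ 0 := fun h0 => by simp [(hbot i h0).1.2] at hmark
    have hpred : ((⟨i - 1, by omega⟩ : Fin (n + r)) : ℕ) + 1 = i := by simp only; omega
    exact (hR PF S i).2 ⟨_, hpred, (hstep i _ hpred).2 hmark⟩

theorem markedPF_finite (M : Row → Row → Prop) (r : ℕ) {ℓ : ℕ} (β : Fin ℓ → ℕ) (m : ℤ) :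
    (markedPF M r β m).Finite := by
  refine (((ExtWPF.finite_weight_eq (∑ i, β i) r (monoExp β)).prod Set.finite_univ).image
    fun p : _ × Finset _ => p.1.rows p.2).subset fun V hV => ?_
  obtain ⟨PF, S, rfl⟩ := exists_rows_eq rfl hV
  exact ⟨(PF, S), ⟨(labels_rows_eq_content_iff β PF S).1 hV.2.1, trivial⟩, rfl⟩

end Rows

/-! ### Generating polynomials of marked parking functions -/

theorem zCoeff_prod {ι : Type*} (e : ℤ) (a : Kqt) (s : Finset ι) (c : ι → Kqt) :
    zCoeff e (Polynomial.C a * ∏ i ∈ s, (1 + Polynomial.C (c i) * Polynomial.X)) =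
      ∑ S ∈ s.powerset with (#S : ℤ) = e, a * ∏ i ∈ S, c i := by
  rw [zCoeff, Finset.prod_one_add]
  simp only [Finset.prod_mul_distrib, Finset.prod_const, ← map_prod]
  split_ifs with he
  · rw [Polynomial.coeff_C_mul, Polynomial.finsetSum_coeff, Finset.mul_sum, Finset.sum_filter]
    refine Finset.sum_congr rfl fun S _ => ?_
    have hcard : e.toNat = #S ↔ (#S : ℤ) = e := by omega
    rw [Polynomial.coeff_C_mul, Polynomial.coeff_X_pow]
    simp [hcard]
  · rw [Finset.filter_false_of_mem fun S _ => by omega, Finset.sum_empty]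

theorem coeff_genSeries_zCoeff {n r : ℕ} {M : Row → Row → Prop}
    {R : ExtWPF n r → Finset (Fin (n + r))}
    (hR : ∀ PF S i, i ∈ R PF ↔
      ∃ j : Fin (n + r), (j : ℕ) + 1 = i ∧ M (PF.row S i) (PF.row S j))
    {ℓ : ℕ} {β : Fin ℓ → ℕ} (hβ : ∑ i, β i = n) (k : ℤ)
    {a : ExtWPF n r → Kqt} {c : ExtWPF n r → Fin (n + r) → Kqt} {F : List Row → Kqt}
    (hF : ∀ PF S, S ⊆ R PF → a PF * ∏ i ∈ S, c PF i = F (PF.rows S)) :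
    MvPowerSeries.coeff (monoExp β) (genSeries fun PF => zCoeff (n - k - 1)
        (Polynomial.C (a PF) * ∏ i ∈ R PF, (1 + Polynomial.C (c PF i) * Polynomial.X))) =
      ∑ V ∈ (markedPF_finite M r β (k + r + 1)).toFinset, F V := by
  simp only [zCoeff_prod]
  let D : Finset (ExtWPF n r × Finset (Fin (n + r))) :=
    {p ∈ (ExtWPF.finite_weight_eq n r (monoExp β)).toFinset ×ˢ univ |
      p.2 ⊆ R p.1 ∧ (#p.2 : ℤ) = n - k - 1}
  have hbij : Set.BijOn (fun p => p.1.rows p.2) (D : Set (ExtWPF n r × Finset (Fin (n + r))))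
      (markedPF_finite M r β (k + r + 1)).toFinset := by
    simpa [D] using bijOn_rows hR hβ k
  refine (Finset.sum_finset_product' D _ _ (by simp [D])).symm.trans ?_
  refine Finset.sum_nbij _ (fun p hp => hbij.mapsTo hp) hbij.injOn hbij.surjOn fun p hp => ?_
  exact hF p.1 p.2 (Finset.mem_filter.1 hp).2.1

noncomputable section

/-- The polynomial in `q` (the variable `0`) and `t` (the variable `1`) with a term `t^f q^g` for
each marked parking function. -/
def markedPoly (M : Row → Row → Prop) (r : ℕ) {ℓ : ℕ} (β : Fin ℓ → ℕ) (m : ℤ)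
    (f g : List Row → ℕ) : MvPolynomial (Fin 2) ℤ :=
  ∑ V ∈ (markedPF_finite M r β m).toFinset, MvPolynomial.X 1 ^ f V * MvPolynomial.X 0 ^ g V

/-- The polynomial representing the coefficient at `monoExp β` of the rise side, `m` being the
number of unmarked rows. -/
def risePoly (r : ℕ) {ℓ : ℕ} (β : Fin ℓ → ℕ) (m : ℤ) : MvPolynomial (Fin 2) ℤ :=
  markedPoly Row.IsRise r β m unmarkedArea totalDinv

/-- The polynomial representing the coefficient at `monoExp β` of the valley side, `m` being the
number of unmarked rows. By `numMarks_le_unmarkedDinv` the subtraction does not truncate. -/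
def valPoly (r : ℕ) {ℓ : ℕ} (β : Fin ℓ → ℕ) (m : ℤ) : MvPolynomial (Fin 2) ℤ :=
  markedPoly Row.IsVal r β m totalArea fun V => unmarkedDinv V - numMarks V

end

theorem map_markedPoly (M : Row → Row → Prop) (r : ℕ) {ℓ : ℕ} (β : Fin ℓ → ℕ) (m : ℤ)
    (f g : List Row → ℕ) :
    algebraMap (MvPolynomial (Fin 2) ℤ) Kqt (markedPoly M r β m f g) =
      ∑ V ∈ (markedPF_finite M r β m).toFinset, t ^ f V * q ^ g V := by
  simp only [markedPoly, map_sum, map_mul, map_pow, t, q]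

theorem q_ne_zero : q ≠ 0 := by
  rw [q, Ne, IsFractionRing.to_map_eq_zero_iff]
  exact MvPolynomial.X_ne_zero _

theorem t_ne_zero : t ≠ 0 := by
  rw [t, Ne, IsFractionRing.to_map_eq_zero_iff]
  exact MvPolynomial.X_ne_zero _

theorem pow_add_sum_mul_prod_one_div {K ι : Type*} [Field K] {x : K} (hx : x ≠ 0) (e : ℕ)
    (s : Finset ι) (f : ι → ℕ) : x ^ (e + ∑ i ∈ s, f i) * ∏ i ∈ s, 1 / x ^ f i = x ^ e := by
  rw [pow_add, ← Finset.prod_pow_eq_pow_sum, mul_assoc, ← Finset.prod_mul_distrib]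
  simp [hx]

theorem mem_Rise_iff {n r : ℕ} (PF : ExtWPF n r) (S : Finset (Fin (n + r))) (i : Fin (n + r)) :
    i ∈ PF.Rise ↔
      ∃ j : Fin (n + r), (j : ℕ) + 1 = i ∧ Row.IsRise (PF.row S i) (PF.row S j) := by
  simp [ExtWPF.Rise, Row.IsRise, ExtWPF.row]

theorem mem_Val_iff {n r : ℕ} (PF : ExtWPF n r) (S : Finset (Fin (n + r))) (i : Fin (n + r)) :
    i ∈ PF.Val ↔
      ∃ j : Fin (n + r), (j : ℕ) + 1 = i ∧ Row.IsVal (PF.row S i) (PF.row S j) := by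
  simp [ExtWPF.Val, Row.IsVal, ExtWPF.row]

theorem algebraMap_risePoly {n ℓ : ℕ} (r : ℕ) {β : Fin ℓ → ℕ} (hβ : ∑ i, β i = n) (k : ℤ) :
    algebraMap (MvPolynomial (Fin 2) ℤ) Kqt (risePoly r β (k + r + 1)) =
      MvPowerSeries.coeff (monoExp β) (riseSide r n k) := by
  rw [risePoly, map_markedPoly]
  refine (coeff_genSeries_zCoeff mem_Rise_iff hβ k fun PF S _ => ?_).symm
  rw [totalDinv_rows, ← unmarkedArea_rows PF S, mul_right_comm,
    pow_add_sum_mul_prod_one_div t_ne_zero]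

theorem algebraMap_valPoly {n ℓ : ℕ} (r : ℕ) {β : Fin ℓ → ℕ} (hβ : ∑ i, β i = n) (k : ℤ) :
    algebraMap (MvPolynomial (Fin 2) ℤ) Kqt (valPoly r β (k + r + 1)) =
      MvPowerSeries.coeff (monoExp β) (valSide r n k) := by
  rw [valPoly, map_markedPoly]
  refine (coeff_genSeries_zCoeff mem_Val_iff hβ k fun PF S hS => ?_).symm
  have hlinked := linked_rows PF fun i hi => (mem_Val_iff PF S i).1 (hS hi)
  have hle := numMarks_le_unmarkedDinv (hlinked.imp (fun _ _ => id) fun _ hx => hx.1)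
  have hdinv : PF.dinv =
      unmarkedDinv (PF.rows S) - numMarks (PF.rows S) + ∑ i ∈ S, (PF.rowDinv i + 1) := by
    rw [numMarks_rows] at hle ⊢
    rw [← unmarkedDinv_rows PF S, Finset.sum_add_distrib, Finset.sum_const, smul_eq_mul, mul_one]
    omega
  rw [totalArea_rows, hdinv, mul_assoc, pow_add_sum_mul_prod_one_div q_ne_zero]

section Specialization

variable {M : Row → Row → Prop} {r ℓ : ℕ} {β : Fin ℓ → ℕ} {m : ℤ} {f g : List Row → ℕ}
  {stat : List (Finset ℕ) → ℕ} {Φ : List (Finset ℕ) → List Row}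

theorem sum_X_pow_eq_genPoly {s : Finset (List Row)} (hΦ : Set.BijOn Φ (OP r β m) s)
    (hstat : ∀ π ∈ OP r β m, g (Φ π) = stat π) :
    ∑ V ∈ s, (Polynomial.X : ℤ[X]) ^ g V = genPoly r β m stat := by
  refine (Finset.sum_nbij Φ ?_ ?_ ?_ ?_).symm
  · exact fun π hπ => hΦ.mapsTo ((Set.Finite.mem_toFinset _).1 hπ)
  · simpa using hΦ.injOn
  · simpa using hΦ.surjOn
  · exact fun π hπ => by rw [hstat π ((Set.Finite.mem_toFinset _).1 hπ)]

theorem aeval_X_zero_markedPoly (hΦ : Set.BijOn Φ (OP r β m) {V ∈ markedPF M r β m | f V = 0})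
    (hstat : ∀ π ∈ OP r β m, g (Φ π) = stat π) :
    MvPolynomial.aeval ![(Polynomial.X : ℤ[X]), 0] (markedPoly M r β m f g) =
      genPoly r β m stat := by
  rw [← sum_X_pow_eq_genPoly
    (s := {V ∈ (markedPF_finite M r β m).toFinset | f V = 0}) (by simpa using hΦ) hstat]
  simp [markedPoly, zero_pow_eq, Finset.sum_filter]

theorem aeval_zero_X_markedPoly (hΦ : Set.BijOn Φ (OP r β m) {V ∈ markedPF M r β m | g V = 0})
    (hstat : ∀ π ∈ OP r β m, f (Φ π) = stat π) :
    MvPolynomial.aeval ![0, (Polynomial.X : ℤ[X])] (markedPoly M r β m f g) =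
      genPoly r β m stat := by
  rw [← sum_X_pow_eq_genPoly
    (s := {V ∈ (markedPF_finite M r β m).toFinset | g V = 0}) (by simpa using hΦ) hstat]
  simp [markedPoly, zero_pow_eq, Finset.sum_filter]

end Specialization

/-! ### Words of ordered multiset partitions -/

/-- The entries of a block in decreasing order, all but the smallest one being marked. -/
def blockWord (B : Finset ℕ) : List (ℕ × Bool) :=
  (B.sort (· ≥ ·)).map fun x => (x, decide (∃ y ∈ B, y < x))

/-- The word `sigma π`, all letters but the minima of the blocks being marked. -/
def blocksWord (π : List (Finset ℕ)) : List (ℕ × Bool) := π.flatMap blockWord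

@[simp] theorem blocksWord_cons (B : Finset ℕ) (π : List (Finset ℕ)) :
    blocksWord (B :: π) = blockWord B ++ blocksWord π := rfl

@[simp] theorem blockWord_singleton (x : ℕ) : blockWord {x} = [(x, false)] := by
  simp [blockWord]

theorem blockWord_insert {B : Finset ℕ} (hB : B.Nonempty) {x : ℕ} (hx : ∀ b ∈ B, b < x) :
    blockWord (insert x B) = (x, true) :: blockWord B := by
  rw [blockWord, Finset.sort_insert _ (fun b hb => (hx b hb).le) (fun h => (hx x h).false),
    List.map_cons]
  obtain ⟨b, hb⟩ := hB
  congr 1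
  · simp only [Finset.mem_insert, Prod.mk.injEq, decide_eq_true_eq, true_and]
    exact ⟨b, Or.inr hb, hx b hb⟩
  · refine List.map_congr_left fun y hy => ?_
    have hyx : ¬ x < y := (hx y (by simpa using hy)).not_gt
    simp [hyx]

@[elab_as_elim]
theorem block_induction {P : ∀ B : Finset ℕ, B.Nonempty → Prop}
    (singleton : ∀ x, P {x} (Finset.singleton_nonempty x))
    (insert_max : ∀ x B (hB : B.Nonempty), (∀ b ∈ B, b < x) → P B hB →
      P (insert x B) (Finset.insert_nonempty x B)) (B : Finset ℕ) (hB : B.Nonempty) : P B hB := by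
  induction B using Finset.induction_on_max with
  | empty => simp at hB
  | insert x B hx ih =>
    rcases B.eq_empty_or_nonempty with rfl | h
    · exact singleton x
    · exact insert_max x B h hx (ih h)

theorem length_blockWord {B : Finset ℕ} (hB : B.Nonempty) :
    (blockWord B).length = (blockWord B).countP (fun x => x.2) + 1 := by
  induction B, hB using block_induction with
  | singleton x => simp
  | insert_max x B hB hx ih => simp [blockWord_insert hB hx, ih]

theorem length_blocksWord {π : List (Finset ℕ)} (hπ : ∀ B ∈ π, B.Nonempty) :
    (blocksWord π).length = (blocksWord π).countP (fun x => x.2) + π.length := by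
  induction π with
  | nil => rfl
  | cons B π ih =>
    rw [List.forall_mem_cons] at hπ
    rw [blocksWord_cons, List.length_append, List.countP_append, length_blockWord hπ.1, ih hπ.2,
      List.length_cons]
    omega

theorem map_fst_blocksWord (π : List (Finset ℕ)) : (blocksWord π).map Prod.fst = sigma π := by
  simp [blocksWord, blockWord, sigma, List.map_flatMap, Function.comp_def]

theorem coe_sigma (π : List (Finset ℕ)) : (sigma π : Multiset ℕ) = (π.map Finset.val).sum := by
  induction π with
  | nil => rfl
  | cons B π ih =>
    rw [List.map_cons, List.sum_cons, ← ih, sigma, List.flatMap_cons, ← Multiset.coe_add,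
      Finset.sort_eq]
    rfl

/-- The inverse of `blocksWord`: each unmarked letter ends a block. -/
def decodeWord : List (ℕ × Bool) → List (Finset ℕ)
  | [] => []
  | (x, false) :: w => {x} :: decodeWord w
  | (x, true) :: w =>
    match decodeWord w with
    | [] => []
    | B :: π => insert x B :: π

theorem decodeWord_blockWord_append {B : Finset ℕ} (hB : B.Nonempty) (w : List (ℕ × Bool)) :
    decodeWord (blockWord B ++ w) = B :: decodeWord w := by
  induction B, hB using block_induction with
  | singleton x => simp [decodeWord]
  | insert_max x B hB hx ih => rw [blockWord_insert hB hx, List.cons_append, decodeWord, ih]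

theorem decodeWord_blocksWord {π : List (Finset ℕ)} (hπ : ∀ B ∈ π, B.Nonempty) :
    decodeWord (blocksWord π) = π := by
  induction π with
  | nil => rfl
  | cons B π ih =>
    rw [List.forall_mem_cons] at hπ
    rw [blocksWord_cons, decodeWord_blockWord_append hπ.1, ih hπ.2]

/-- The words of ordered multiset partitions whose last block does not contain `0`. -/
abbrev ValidWord (w : List (ℕ × Bool)) : Prop :=
  Linked (fun y x => y.2 = true → x.1 < y.1) (fun x => x.2 = false ∧ x.1 ≠ 0) w

theorem blockWord_ne_nil {B : Finset ℕ} (hB : B.Nonempty) : blockWord B ≠ [] := by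
  simp [blockWord, hB.ne_empty, ← List.length_eq_zero_iff]

theorem head?_blockWord_append_lt_iff {B : Finset ℕ} (hB : B.Nonempty) (w : List (ℕ × Bool))
    (x : ℕ) : (∀ y ∈ (blockWord B ++ w).head?, y.1 < x) ↔ ∀ b ∈ B, b < x := by
  induction B, hB using block_induction with
  | singleton z => simp
  | insert_max z B hB hz _ =>
    simp only [blockWord_insert hB hz, List.cons_append, List.head?_cons, Option.mem_some_iff,
      forall_eq', Finset.forall_mem_insert]
    exact ⟨fun hzx => ⟨hzx, fun b hb => (hz b hb).trans hzx⟩, And.left⟩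

theorem validWord_blockWord_append_iff {B : Finset ℕ} (hB : B.Nonempty) {w : List (ℕ × Bool)} :
    ValidWord (blockWord B ++ w) ↔ (w = [] → 0 ∉ B) ∧ ValidWord w := by
  induction B, hB using block_induction with
  | singleton x =>
    rw [blockWord_singleton, List.singleton_append]
    refine linked_cons.trans ?_
    simp [eq_comm (a := 0)]
  | insert_max x B hB hx ih =>
    have hx0 : 0 ≠ x := (Nat.zero_lt_of_lt (hx _ hB.choose_spec)).ne
    have hhead := (head?_blockWord_append_lt_iff hB w x).2 hx
    rw [blockWord_insert hB hx, List.cons_append]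
    refine linked_cons.trans ?_
    rw [Finset.mem_insert, or_iff_right hx0, ← ih]
    have hnil : blockWord B ++ w ≠ [] := by simp [blockWord_ne_nil hB]
    exact ⟨fun h => h.2.2, fun h => ⟨fun y hy _ => hhead y hy, fun h' => absurd h' hnil, h⟩⟩

theorem validWord_blocksWord_iff {π : List (Finset ℕ)} (hπ : ∀ B ∈ π, B.Nonempty) :
    ValidWord (blocksWord π) ↔ ∀ B, π.getLast? = some B → 0 ∉ B := by
  induction π with
  | nil => simp [blocksWord]
  | cons B π ih =>
    rw [List.forall_mem_cons] at hπ
    rw [blocksWord_cons, validWord_blockWord_append_iff hπ.1, ih hπ.2]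
    cases π with
    | nil => simp [blocksWord]
    | cons C π => simp [blockWord_ne_nil (hπ.2 C (by simp))]

theorem exists_blocksWord_eq {w : List (ℕ × Bool)} (hw : ValidWord w) :
    ∃ π : List (Finset ℕ), (∀ B ∈ π, B.Nonempty) ∧ blocksWord π = w := by
  induction w with
  | nil => exact ⟨[], by simp, rfl⟩
  | cons y w ih =>
    obtain ⟨hhead, hlast, hvalid⟩ := linked_cons.1 hw
    obtain ⟨π, hπ, rfl⟩ := ih hvalid
    rcases y with ⟨x, _ | _⟩
    · exact ⟨{x} :: π, by simpa using hπ, by simp⟩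
    · cases π with
      | nil => simpa using (hlast rfl).1
      | cons C π =>
        rw [List.forall_mem_cons] at hπ
        have hx := (head?_blockWord_append_lt_iff hπ.1 (blocksWord π) x).1
          fun z hz => hhead z hz rfl
        exact ⟨insert x C :: π, by simpa using hπ.2, by simp [blockWord_insert hπ.1 hx]⟩

/-! ### Parking functions whose areas are determined by their marked labels -/

/-- The label of a row, with its mark. -/
def Row.letter (x : Row) : ℕ × Bool := (x.label, x.mark)

section Arrange

variable {α : ℕ → Bool → Row → ℕ}

/-- The list of rows with given marked labels: the bottom row has area `0`, and the area of the
row with label `l` and mark `m` above `x` is `α l m x`. -/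
def arrange (α : ℕ → Bool → Row → ℕ) : List (ℕ × Bool) → List Row
  | [] => []
  | (l, m) :: w =>
    match arrange α w with
    | [] => [⟨0, l, m⟩]
    | x :: V => ⟨α l m x, l, m⟩ :: x :: V

/-- The lists of rows obtained by `arrange α` from valid words. -/
abbrev Arranged (α : ℕ → Bool → Row → ℕ) (V : List Row) : Prop :=
  Linked (fun y x => y.area = α y.label y.mark x ∧ (y.mark = true → x.label < y.label))
    Row.IsBottom V

theorem arranged_cons_cons {y x : Row} {V : List Row} :
    Arranged α (y :: x :: V) ↔
      (y.area = α y.label y.mark x ∧ (y.mark = true → x.label < y.label)) ∧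
        Arranged α (x :: V) := linked_cons_cons

theorem map_letter_arrange (α : ℕ → Bool → Row → ℕ) (w : List (ℕ × Bool)) :
    (arrange α w).map Row.letter = w := by
  induction w with
  | nil => rfl
  | cons y w ih =>
    rw [arrange]
    cases h : arrange α w <;> simp_all [Row.letter]

theorem arrange_map_letter {V : List Row} (hV : Arranged α V) :
    arrange α (V.map Row.letter) = V := by
  induction V with
  | nil => rfl
  | cons y V ih =>
    rw [List.map_cons, Row.letter, arrange, ih hV.tail]
    cases V with
    | nil => simp [← (linked_singleton.1 hV).1.1]
    | cons x V => simp [← (arranged_cons_cons.1 hV).1.1]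

theorem arranged_arrange {w : List (ℕ × Bool)} (hw : ValidWord w) : Arranged α (arrange α w) := by
  induction w with
  | nil => exact linked_nil
  | cons y w ih =>
    have htail := ih hw.tail
    have hletter := map_letter_arrange α w
    rw [arrange]
    cases h : arrange α w with
    | nil =>
      rw [h] at hletter
      subst hletter
      simpa [Row.IsBottom, Row.IsGround] using hw
    | cons x V =>
      rw [h] at htail hletter
      subst hletter
      exact arranged_cons_cons.2 ⟨⟨rfl, (linked_cons_cons.1 hw).1⟩, htail⟩

theorem Arranged.validWord {V : List Row} (hV : Arranged α V) : ValidWord (V.map Row.letter) :=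
  linked_map.2 (hV.imp (fun _ _ h => h.2) fun _ h => ⟨h.1.2, h.2⟩)

theorem numMarks_eq_countP (V : List Row) :
    numMarks V = (V.map Row.letter).countP (fun x => x.2) := by
  rw [numMarks, List.countP_map]
  rfl

theorem map_label_eq (V : List Row) : V.map Row.label = (V.map Row.letter).map Prod.fst := by
  rw [List.map_map]
  rfl

theorem arrange_blocksWord_mem_markedPF_iff {M : Row → Row → Prop} {r ℓ : ℕ} {β : Fin ℓ → ℕ}
    {m : ℤ} {π : List (Finset ℕ)} (hπ : ∀ B ∈ π, B.Nonempty)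
    (hM : Linked (MarkedStep M) Row.IsBottom (arrange α (blocksWord π)))
    (h0 : ∀ B, π.getLast? = some B → 0 ∉ B) :
    arrange α (blocksWord π) ∈ markedPF M r β m ↔ π ∈ OP r β m := by
  have hlength : ((arrange α (blocksWord π)).length : ℤ) - numMarks (arrange α (blocksWord π)) =
      π.length := by
    rw [numMarks_eq_countP, ← List.length_map (f := Row.letter), map_letter_arrange,
      length_blocksWord hπ]
    push_cast
    ring
  simp only [markedPF, OP, Set.mem_ofPred_eq, map_label_eq, map_letter_arrange,
    map_fst_blocksWord, coe_sigma, hlength]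
  tauto

theorem bijOn_arrange {M : Row → Row → Prop} {p : List Row → Prop}
    (h : ∀ V, Linked (MarkedStep M) Row.IsBottom V ∧ p V ↔ Arranged α V) (r : ℕ) {ℓ : ℕ}
    (β : Fin ℓ → ℕ) (m : ℤ) :
    Set.BijOn (fun π => arrange α (blocksWord π)) (OP r β m) {V ∈ markedPF M r β m | p V} := by
  have harranged {π : List (Finset ℕ)} (hπ : ∀ B ∈ π, B.Nonempty)
      (h0 : ∀ B, π.getLast? = some B → 0 ∉ B) :=
    (h _).2 (arranged_arrange (α := α) ((validWord_blocksWord_iff hπ).2 h0))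
  refine ⟨?_, ?_, ?_⟩
  · intro π hπ
    obtain ⟨hM, hp⟩ := harranged hπ.1 hπ.2.2.1
    exact ⟨(arrange_blocksWord_mem_markedPF_iff hπ.1 hM hπ.2.2.1).2 hπ, hp⟩
  · rintro π ⟨hπ, -⟩ π' ⟨hπ', -⟩ heq
    have hword := congrArg (List.map Row.letter) heq
    simp only [map_letter_arrange] at hword
    rw [← decodeWord_blocksWord hπ, hword, decodeWord_blocksWord hπ']
  · rintro V ⟨hV, hp⟩
    have hV' := (h V).1 ⟨hV.1, hp⟩
    obtain ⟨π, hπ, hword⟩ := exists_blocksWord_eq hV'.validWord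
    have h0 := (validWord_blocksWord_iff hπ).1 (hword ▸ hV'.validWord)
    have heq : arrange α (blocksWord π) = V := by rw [hword, arrange_map_letter hV']
    refine ⟨π, (arrange_blocksWord_mem_markedPF_iff hπ (harranged hπ h0).1 h0).1 ?_, heq⟩
    rwa [heq]

end Arrange

/-! ### Parking functions of area zero, and `inv` -/

/-- The row of area `0` with a given marked label. -/
def flatRow (x : ℕ × Bool) : Row := ⟨0, x.1, x.2⟩

theorem sum_map_sort {B : Finset ℕ} {s : ℕ → ℕ → Prop} [DecidableRel s] [Std.Total s]
    [IsTrans ℕ s] [Std.Antisymm s] (f : ℕ → ℕ) : ((B.sort s).map f).sum = ∑ x ∈ B, f x := by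
  rw [← Multiset.sum_coe, ← Multiset.map_coe, Finset.sort_eq]
  rfl

theorem arrange_zero (w : List (ℕ × Bool)) : arrange (fun _ _ _ => 0) w = w.map flatRow := by
  induction w with
  | nil => rfl
  | cons y w ih =>
    rw [arrange, ih]
    cases w <;> rfl

theorem linked_isVal_and_totalArea_eq_zero_iff (V : List Row) :
    Linked (MarkedStep Row.IsVal) Row.IsBottom V ∧ totalArea V = 0 ↔
      Arranged (fun _ _ _ => 0) V := by
  induction V with
  | nil => simp [totalArea]
  | cons y V ih =>
    cases V with
    | nil => simp +contextual [totalArea, Row.IsBottom, Row.IsGround]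
    | cons x V =>
      rw [linked_cons_cons, arranged_cons_cons, ← ih]
      simp only [totalArea_cons, MarkedStep, Row.Step, Row.IsVal]
      constructor
      · rintro ⟨⟨⟨-, hval⟩, hV⟩, harea⟩
        exact ⟨⟨by omega, fun hy => by have := hval hy; omega⟩, hV, by omega⟩
      · rintro ⟨⟨harea, hlt⟩, hV, hsum⟩
        exact ⟨⟨⟨by omega, fun hy => Or.inr ⟨by omega, hlt hy⟩⟩, hV⟩, by omega⟩

theorem attackers_flatRow_blockWord {B : Finset ℕ} (hB : B.Nonempty) {x : ℕ}
    (hx : ∀ b ∈ B, b < x) (m : Bool) :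
    attackers (flatRow (x, m)) ((blockWord B).map flatRow) = 1 := by
  induction B, hB using block_induction with
  | singleton y => simp [attackers, flatRow, Row.Attacks, hx y (by simp)]
  | insert_max y B hB hy ih =>
    rw [blockWord_insert hB hy]
    simpa [attackers, flatRow] using ih fun b hb => hx b (by simp [hb])

theorem unmarkedDinv_flatRow_blockWord {B : Finset ℕ} (hB : B.Nonempty) :
    unmarkedDinv ((blockWord B).map flatRow) = numMarks ((blockWord B).map flatRow) := by
  induction B, hB using block_induction with
  | singleton x => simp [unmarkedDinv, numMarks, flatRow]
  | insert_max x B hB hx ih =>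
    rw [blockWord_insert hB hx, List.map_cons, unmarkedDinv_cons, numMarks_cons, ih,
      attackers_flatRow_blockWord hB hx, add_comm]
    simp [flatRow]

theorem crossSum_flatRow_blockWord (B C : Finset ℕ) :
    crossSum (fun y x => if x.mark = false ∧ x.Attacks y then 1 else 0)
        ((blockWord B).map flatRow) ((blockWord C).map flatRow) =
      #{p ∈ B ×ˢ C | p.2 < p.1 ∧ ∀ c ∈ C, p.2 ≤ c} := by
  simp only [crossSum, blockWord, List.map_map, Function.comp_def, sum_map_sort]
  rw [Finset.card_filter, Finset.sum_product]
  refine Finset.sum_congr rfl fun y _ => Finset.sum_congr rfl fun x _ => if_congr ?_ rfl rfl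
  have hmin : (∀ z < x, z ∉ C) ↔ ∀ c ∈ C, x ≤ c :=
    forall_congr' fun c => by rw [imp_not_comm, not_lt]
  simp [flatRow, Row.Attacks, and_comm, hmin]

theorem unmarkedDinv_flatRow_blocksWord {π : List (Finset ℕ)} (hπ : ∀ B ∈ π, B.Nonempty) :
    unmarkedDinv ((blocksWord π).map flatRow) =
      inv π + numMarks ((blocksWord π).map flatRow) := by
  rw [blocksWord, List.map_flatMap, unmarkedDinv, pairSum_flatMap, numMarks, List.countP_flatMap,
    inv, ← pairSum_eq_sum_get fun B C => #{p ∈ B ×ˢ C | p.2 < p.1 ∧ ∀ c ∈ C, p.2 ≤ c}]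
  simp only [crossSum_flatRow_blockWord]
  congr 2
  exact List.map_congr_left fun B hB => unmarkedDinv_flatRow_blockWord (hπ B hB)

theorem aeval_X_zero_valPoly (r : ℕ) {ℓ : ℕ} (β : Fin ℓ → ℕ) (m : ℤ) :
    MvPolynomial.aeval ![Polynomial.X, 0] (valPoly r β m) = genPoly r β m inv := by
  refine aeval_X_zero_markedPoly
    (bijOn_arrange linked_isVal_and_totalArea_eq_zero_iff r β m) fun π hπ => ?_
  rw [arrange_zero, unmarkedDinv_flatRow_blocksWord hπ.1, Nat.add_sub_cancel]

/-! ### Sums over the descents of a word -/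

/-- The sum of the weights (second components) of the letters of a word that follow a larger
letter. Both `opMaj` and `wordMaj` are of this form. -/
def descSum : List (ℕ × ℕ) → ℕ
  | [] => 0
  | [_] => 0
  | x :: y :: l => (if y.1 < x.1 then y.2 else 0) + descSum (y :: l)

/-- The number of descents of a word. -/
def desc (w : List ℕ) : ℕ := descSum (w.map fun x => (x, 1))

@[simp] theorem descSum_cons_cons (x y : ℕ × ℕ) (l : List (ℕ × ℕ)) :
    descSum (x :: y :: l) = (if y.1 < x.1 then y.2 else 0) + descSum (y :: l) := rfl

@[simp] theorem desc_cons_cons (x y : ℕ) (w : List ℕ) :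
    desc (x :: y :: w) = (if y < x then 1 else 0) + desc (y :: w) := rfl

theorem descSum_zip {s d : List ℕ} (h : s.length = d.length) :
    descSum (s.zip d) =
      ∑ i ∈ range (s.length - 1),
        if s.getD (i + 1) 0 < s.getD i 0 then d.getD (i + 1) 0 else 0 := by
  induction s generalizing d with
  | nil => rfl
  | cons x s ih =>
    obtain ⟨e, d, rfl⟩ := List.exists_cons_of_length_eq_add_one h.symm
    cases s with
    | nil => simp [descSum]
    | cons y s =>
      obtain ⟨f, d, rfl⟩ := List.exists_cons_of_length_eq_add_one (Nat.succ.inj h).symm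
      have htail := ih (Nat.succ.inj h)
      rw [List.zip_cons_cons] at htail
      rw [List.zip_cons_cons, List.zip_cons_cons, descSum_cons_cons, htail, List.length_cons,
        List.length_cons, Nat.add_sub_cancel, Nat.add_sub_cancel, List.length_cons,
        Finset.sum_range_succ', add_comm]
      simp

theorem descSum_cons_of_head {L : List (ℕ × ℕ)} (hL : ∀ y ∈ L.head?, y.2 = 0) (x : ℕ × ℕ) :
    descSum (x :: L) = descSum L := by
  cases L with
  | nil => rfl
  | cons y L => simp [hL y rfl]

theorem descSum_map_succ (L : List (ℕ × ℕ)) :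
    descSum (L.map fun x => (x.1, x.2 + 1)) = descSum L + desc (L.map Prod.fst) := by
  induction L with
  | nil => rfl
  | cons x L ih =>
    cases L with
    | nil => rfl
    | cons y L =>
      simp only [List.map_cons, descSum_cons_cons, desc_cons_cons] at ih ⊢
      rw [ih]
      split_ifs <;> omega

theorem descSum_cons_map_succ {L : List (ℕ × ℕ)} (hL : ∀ y ∈ L.head?, y.2 = 0) (x : ℕ × ℕ) :
    descSum (x :: L.map fun x => (x.1, x.2 + 1)) =
      desc (x.1 :: L.map Prod.fst) + descSum L := by
  rw [← descSum_cons_of_head hL x, add_comm]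
  cases L with
  | nil => rfl
  | cons y L =>
    have hsucc := descSum_map_succ (y :: L)
    simp only [List.map_cons, descSum_cons_cons, desc_cons_cons, hL y rfl] at hsucc ⊢
    rw [hsucc]
    split_ifs <;> omega

/-! ### Parking functions with `dinv` zero, and `maj` -/

/-- The area of a row with label `l` above `x` that is not a contractible valley. -/
def ascArea (l : ℕ) (_ : Bool) (x : Row) : ℕ := if x.label < l then x.area + 1 else x.area

theorem Row.area_eq_ascArea_iff {y x : Row} {m : Bool} :
    y.area = ascArea y.label m x ↔ ¬ y.IsVal x ∧ y.Step x := by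
  simp only [ascArea, IsVal, Step]
  split_ifs <;> omega

theorem exists_attacks {V : List Row} (hV : Linked Row.Step (fun x => x.area = 0) V) {e : Row}
    (h : ∃ x ∈ V, e.IsVal x) : ∃ y ∈ V, y.Attacks e := by
  let unmark (x : Row) : Row := { x with mark := false }
  have hunmark : Linked (MarkedStep Row.IsVal) Row.IsGround (V.map unmark) :=
    linked_map.2 (hV.imp (fun _ _ hstep => ⟨hstep, nofun⟩) fun _ hx => ⟨hx, rfl⟩)
  obtain ⟨x, hx, hval⟩ := h
  obtain ⟨y, hy, -, hatt⟩ :=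
    exists_unmarked_attacks hunmark ⟨unmark x, List.mem_map_of_mem hx, hval⟩
  obtain ⟨z, hz, rfl⟩ := List.mem_map.1 hy
  exact ⟨z, hz, hatt⟩

theorem totalDinv_cons_eq_zero_iff {y : Row} {V : List Row} :
    totalDinv (y :: V) = 0 ↔ (∀ x ∈ V, ¬ x.Attacks y) ∧ totalDinv V = 0 := by
  simp [totalDinv, List.sum_eq_zero_iff]

theorem Arranged.not_isVal {V : List Row} {y : Row} (h : Arranged ascArea (y :: V)) :
    ∀ x ∈ V, ¬ y.IsVal x := by
  induction V generalizing y with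
  | nil => simp
  | cons z V ih =>
    have hyz := (Row.area_eq_ascArea_iff.1 (arranged_cons_cons.1 h).1.1).1
    rw [List.forall_mem_cons]
    exact ⟨hyz, fun x hx => Row.not_isVal_trans hyz (ih h.tail x hx)⟩

theorem Arranged.forall_not_attacks_iff {x : Row} {V : List Row} (h : Arranged ascArea (x :: V))
    {y : Row} : (∀ z ∈ x :: V, ¬ z.Attacks y) ↔ ¬ y.IsVal x := by
  constructor
  · intro hatt hval
    have hstep : Linked Row.Step (fun x => x.area = 0) (x :: V) :=
      h.imp (fun _ _ hyx => (Row.area_eq_ascArea_iff.1 hyx.1).2) fun _ hx => hx.1.1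
    obtain ⟨z, hz, hzy⟩ := exists_attacks hstep ⟨x, by simp, hval⟩
    exact hatt z hz hzy
  · rw [List.forall_mem_cons]
    exact fun hyx => ⟨fun hatt => hyx (Row.attacks_iff.1 hatt).1, fun z hz hatt =>
      Row.not_isVal_trans hyx (h.not_isVal z hz) (Row.attacks_iff.1 hatt).1⟩

theorem linked_isRise_and_totalDinv_eq_zero_iff (V : List Row) :
    Linked (MarkedStep Row.IsRise) Row.IsBottom V ∧ totalDinv V = 0 ↔ Arranged ascArea V := by
  induction V with
  | nil => simp [totalDinv]
  | cons y V ih =>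
    cases V with
    | nil => simp [totalDinv]
    | cons x V =>
      have hrise (hval : ¬ y.IsVal x) (hstep : y.Step x) : y.IsRise x ↔ x.label < y.label := by
        simp only [Row.IsVal, Row.Step, Row.IsRise] at *
        omega
      rw [linked_cons_cons, arranged_cons_cons, totalDinv_cons_eq_zero_iff,
        Row.area_eq_ascArea_iff, MarkedStep]
      constructor
      · rintro ⟨⟨⟨hstep, hmark⟩, hV⟩, hatt, hdinv⟩
        have harr := ih.1 ⟨hV, hdinv⟩
        have hval := harr.forall_not_attacks_iff.1 hatt
        exact ⟨⟨⟨hval, hstep⟩, fun hy => (hrise hval hstep).1 (hmark hy)⟩, harr⟩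
      · rintro ⟨⟨⟨hval, hstep⟩, hmark⟩, harr⟩
        obtain ⟨hV, hdinv⟩ := ih.2 harr
        exact ⟨⟨⟨hstep, fun hy => (hrise hval hstep).2 (hmark hy)⟩, hV⟩,
          harr.forall_not_attacks_iff.2 hval, hdinv⟩

theorem arrange_ascArea_cons (l : ℕ) (m : Bool) (w : List (ℕ × Bool)) :
    arrange ascArea ((l, m) :: w) = ⟨desc (l :: w.map Prod.fst), l, m⟩ :: arrange ascArea w := by
  induction w generalizing l m with
  | nil => rfl
  | cons y w ih =>
    obtain ⟨l', m'⟩ := y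
    rw [arrange, ih]
    simp only [ascArea, List.map_cons, desc_cons_cons]
    split_ifs <;> simp [add_comm]

/-- The letters of a block in decreasing order, with weight `0`. -/
def blockZip (B : Finset ℕ) : List (ℕ × ℕ) := (B.sort (· ≥ ·)).map fun x => (x, 0)

theorem snd_eq_zero_of_mem_head?_blockZip_append {B : Finset ℕ} (hB : B.Nonempty)
    (L : List (ℕ × ℕ)) : ∀ y ∈ (blockZip B ++ L).head?, y.2 = 0 := by
  obtain ⟨x, l, hx⟩ := List.exists_cons_of_ne_nil
    (show B.sort (· ≥ ·) ≠ [] by simp [← List.length_eq_zero_iff, hB.ne_empty])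
  simp [blockZip, hx]

theorem blockZip_insert {B : Finset ℕ} {x : ℕ} (hx : ∀ b ∈ B, b < x) :
    blockZip (insert x B) = (x, 0) :: blockZip B := by
  rw [blockZip, Finset.sort_insert _ (fun b hb => (hx b hb).le) (fun h => (hx x h).false)]
  rfl

theorem unmarkedArea_arrange_blockWord_append {B : Finset ℕ} (hB : B.Nonempty)
    {w : List (ℕ × Bool)} {L : List (ℕ × ℕ)} (hL : ∀ y ∈ L.head?, y.2 = 0)
    (hw : L.map Prod.fst = w.map Prod.fst) :
    unmarkedArea (arrange ascArea (blockWord B ++ w)) + descSum L =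
      descSum (blockZip B ++ L.map fun x => (x.1, x.2 + 1)) +
        unmarkedArea (arrange ascArea w) := by
  induction B, hB using block_induction with
  | singleton x =>
    have hdesc := descSum_cons_map_succ hL (x, 0)
    rw [hw] at hdesc
    have hzip : blockZip {x} = [(x, 0)] := by simp [blockZip]
    rw [blockWord_singleton, hzip, List.singleton_append, List.singleton_append, hdesc,
      arrange_ascArea_cons, unmarkedArea_cons, if_neg Bool.false_ne_true]
    dsimp only
    omega
  | insert_max x B hB hx ih =>
    rw [blockWord_insert hB hx, List.cons_append, arrange_ascArea_cons, unmarkedArea_cons,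
      if_pos rfl, zero_add, ih, blockZip_insert hx, List.cons_append,
      descSum_cons_of_head (snd_eq_zero_of_mem_head?_blockZip_append hB _)]

theorem ind_cons (B : Finset ℕ) (π : List (Finset ℕ)) :
    ind (B :: π) = List.replicate #B 0 ++ (ind π).map (· + 1) := by
  rw [ind, List.mapIdx_cons, List.flatten_cons, ind, List.map_flatten]
  congr 2
  exact List.ext_getElem (by simp) (by simp)

theorem length_sigma (π : List (Finset ℕ)) : (sigma π).length = (ind π).length := by
  induction π with
  | nil => rfl
  | cons B π ih =>
    rw [ind_cons, List.length_append, List.length_map, ← ih]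
    simp [sigma]

theorem zip_sigma_ind_cons (B : Finset ℕ) (π : List (Finset ℕ)) :
    (sigma (B :: π)).zip (ind (B :: π)) =
      blockZip B ++ ((sigma π).zip (ind π)).map fun x => (x.1, x.2 + 1) := by
  rw [ind_cons, sigma, List.flatMap_cons, ← sigma, List.zip_append (by simp), List.zip_map_right]
  congr 1
  have hzip := List.zip_map' (f := id) (g := fun _ : ℕ => (0 : ℕ)) (l := B.sort (· ≥ ·))
  rwa [List.map_id, List.map_const', Finset.length_sort] at hzip

theorem snd_eq_zero_of_mem_head?_zip_sigma_ind {π : List (Finset ℕ)} (hπ : ∀ B ∈ π, B.Nonempty) :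
    ∀ y ∈ ((sigma π).zip (ind π)).head?, y.2 = 0 := by
  cases π with
  | nil => simp [sigma]
  | cons B π =>
    rw [zip_sigma_ind_cons]
    exact snd_eq_zero_of_mem_head?_blockZip_append (hπ B (by simp)) _

theorem unmarkedArea_arrange_ascArea {π : List (Finset ℕ)} (hπ : ∀ B ∈ π, B.Nonempty) :
    unmarkedArea (arrange ascArea (blocksWord π)) = opMaj π := by
  rw [opMaj, ← descSum_zip (length_sigma π)]
  induction π with
  | nil => rfl
  | cons B π ih =>
    rw [List.forall_mem_cons] at hπ
    have hfst : ((sigma π).zip (ind π)).map Prod.fst = (blocksWord π).map Prod.fst := by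
      rw [List.map_fst_zip (length_sigma π).le, map_fst_blocksWord]
    have hblock := unmarkedArea_arrange_blockWord_append hπ.1
      (snd_eq_zero_of_mem_head?_zip_sigma_ind hπ.2) hfst
    rw [ih hπ.2] at hblock
    rw [blocksWord_cons, zip_sigma_ind_cons]
    exact Nat.add_right_cancel hblock

theorem aeval_zero_X_risePoly (r : ℕ) {ℓ : ℕ} (β : Fin ℓ → ℕ) (m : ℤ) :
    MvPolynomial.aeval ![0, Polynomial.X] (risePoly r β m) = genPoly r β m opMaj :=
  aeval_zero_X_markedPoly (bijOn_arrange linked_isRise_and_totalDinv_eq_zero_iff r β m)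
    fun _ hπ => unmarkedArea_arrange_ascArea hπ.1

/-! ### Parking functions with unmarked area zero, and `dinv` -/

/-- The area of a row with mark `m` above `x`, when the marked rows are the double rises and the
unmarked rows have area `0`. -/
def runArea (_ : ℕ) (m : Bool) (x : Row) : ℕ := if m then x.area + 1 else 0

theorem linked_isRise_and_unmarkedArea_eq_zero_iff (V : List Row) :
    Linked (MarkedStep Row.IsRise) Row.IsBottom V ∧ unmarkedArea V = 0 ↔ Arranged runArea V := by
  induction V with
  | nil => simp [unmarkedArea]
  | cons y V ih =>
    cases V with
    | nil => simp +contextual [unmarkedArea, Row.IsBottom, Row.IsGround]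
    | cons x V =>
      rw [linked_cons_cons, unmarkedArea_cons y, arranged_cons_cons, ← ih]
      rcases y with ⟨a, l, _ | _⟩ <;>
        simp only [MarkedStep, Row.Step, Row.IsRise, runArea] <;> grind

/-- The rows of a column with label set `B`, all but the lowest one being marked. -/
def columnRows (B : Finset ℕ) : List Row :=
  ((List.range #B).map fun h => (⟨h, nthSmallest B h, decide (h ≠ 0)⟩ : Row)).reverse

theorem columnRows_singleton (x : ℕ) : columnRows {x} = [⟨0, x, false⟩] := by
  simp [columnRows, nthSmallest]

theorem sort_le_insert {B : Finset ℕ} {x : ℕ} (hx : ∀ b ∈ B, b < x) :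
    (insert x B).sort (· ≤ ·) = B.sort (· ≤ ·) ++ [x] := by
  refine List.Perm.eq_of_sortedLE (Finset.sortedLT_sort _).sortedLE ?_ ?_
  · refine (List.pairwise_append.2
      ⟨(Finset.sortedLT_sort B).sortedLE.pairwise, by simp, ?_⟩).sortedLE
    simpa using fun b hb => (hx b hb).le
  · rw [← Multiset.coe_eq_coe, ← Multiset.coe_add, Finset.sort_eq, Finset.sort_eq,
      Finset.insert_val_of_notMem fun h => (hx x h).false, add_comm]
    rfl

theorem columnRows_insert {B : Finset ℕ} (hB : B.Nonempty) {x : ℕ} (hx : ∀ b ∈ B, b < x) :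
    columnRows (insert x B) = ⟨#B, x, true⟩ :: columnRows B := by
  have hlast : nthSmallest (insert x B) #B = x := by
    rw [nthSmallest, sort_le_insert hx, List.getD_append_right _ _ _ _ (by simp)]
    simp
  have hrest :
      (List.range #B).map
          (fun h => (⟨h, nthSmallest (insert x B) h, decide (h ≠ 0)⟩ : Row)) =
        (List.range #B).map fun h => ⟨h, nthSmallest B h, decide (h ≠ 0)⟩ := by
    refine List.map_congr_left fun h hh => ?_
    rw [nthSmallest, sort_le_insert hx, List.getD_append _ _ _ _ (by simpa using hh), nthSmallest]
  rw [columnRows, Finset.card_insert_of_notMem fun h => (hx x h).false, List.range_succ,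
    List.map_append, List.reverse_append, hrest]
  simp [hlast, hB.ne_empty, columnRows]

theorem exists_columnRows_eq_cons {B : Finset ℕ} (hB : B.Nonempty) :
    ∃ x V, columnRows B = x :: V ∧ x.area + 1 = #B := by
  induction B, hB using block_induction with
  | singleton x => exact ⟨_, _, columnRows_singleton x, rfl⟩
  | insert_max x B hB hx _ =>
    rw [columnRows_insert hB hx, Finset.card_insert_of_notMem fun h => (hx x h).false]
    exact ⟨_, _, rfl, rfl⟩

theorem arrange_runArea_blockWord_append {B : Finset ℕ} (hB : B.Nonempty) (w : List (ℕ × Bool)) :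
    arrange runArea (blockWord B ++ w) = columnRows B ++ arrange runArea w := by
  induction B, hB using block_induction with
  | singleton x =>
    rw [columnRows_singleton, blockWord_singleton, List.singleton_append, arrange]
    cases arrange runArea w <;> rfl
  | insert_max x B hB hx ih =>
    obtain ⟨y, V, hcol, hy⟩ := exists_columnRows_eq_cons hB
    rw [blockWord_insert hB hx, List.cons_append, arrange, ih, columnRows_insert hB hx, hcol, ← hy]
    rfl

theorem arrange_runArea_blocksWord {π : List (Finset ℕ)} (hπ : ∀ B ∈ π, B.Nonempty) :
    arrange runArea (blocksWord π) = π.flatMap columnRows := by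
  induction π with
  | nil => rfl
  | cons B π ih =>
    rw [List.forall_mem_cons] at hπ
    rw [blocksWord_cons, arrange_runArea_blockWord_append hπ.1, ih hπ.2, List.flatMap_cons]

theorem totalDinv_columnRows {B : Finset ℕ} (hB : B.Nonempty) : totalDinv (columnRows B) = 0 := by
  induction B, hB using block_induction with
  | singleton x => simp [columnRows_singleton, totalDinv]
  | insert_max x B hB hx ih =>
    rw [columnRows_insert hB hx, totalDinv_cons_eq_zero_iff]
    refine ⟨fun z hz => ?_, ih⟩
    obtain ⟨h, hh, rfl⟩ : ∃ h < #B, ⟨h, nthSmallest B h, decide (h ≠ 0)⟩ = z := by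
      simpa [columnRows] using hz
    simp only [Row.Attacks]
    omega

theorem sum_map_columnRows (B : Finset ℕ) (f : Row → ℕ) :
    ((columnRows B).map f).sum = ∑ h ∈ range #B, f ⟨h, nthSmallest B h, decide (h ≠ 0)⟩ := by
  rw [columnRows, List.map_reverse, List.sum_reverse, List.map_map, ← Multiset.sum_coe,
    ← Multiset.map_coe]
  rfl

theorem sum_attacks_columnRows (C : Finset ℕ) (h b : ℕ) (m : Bool) :
    ((columnRows C).map fun x => if x.Attacks ⟨h, b, m⟩ then 1 else 0).sum =
      (if h < #C ∧ nthSmallest C h < b then 1 else 0) +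
        if h + 1 < #C ∧ b < nthSmallest C (h + 1) then 1 else 0 := by
  have hrow (i : ℕ) :
      (if Row.Attacks ⟨i, nthSmallest C i, decide (i ≠ 0)⟩ ⟨h, b, m⟩ then 1 else 0) =
      (if i = h then (if nthSmallest C h < b then 1 else 0) else 0) +
      if i = h + 1 then (if b < nthSmallest C (h + 1) then 1 else 0) else 0 := by
    rcases eq_or_ne i h with rfl | hi
    · simp [Row.Attacks]
    · rcases eq_or_ne i (h + 1) with rfl | hi'
      · simp [Row.Attacks]
      · simp [Row.Attacks, hi, hi']
  simp only [sum_map_columnRows, hrow, Finset.sum_add_distrib, Finset.sum_ite_eq',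
    Finset.mem_range, ite_and]

theorem totalDinv_flatMap_columnRows {π : List (Finset ℕ)} (hπ : ∀ B ∈ π, B.Nonempty) :
    totalDinv (π.flatMap columnRows) = opDinv π := by
  have hcol : (π.map fun B => totalDinv (columnRows B)).sum = 0 := by
    simpa [List.sum_eq_zero_iff] using fun B hB => totalDinv_columnRows (hπ B hB)
  rw [totalDinv, pairSum_flatMap, opDinv, ← pairSum_eq_sum_get fun B C =>
    #{h ∈ range #B | h < #C ∧ nthSmallest C h < nthSmallest B h} +
      #{h ∈ range #B | h + 1 < #C ∧ nthSmallest B h < nthSmallest C (h + 1)}]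
  refine (congrArg (_ + ·) hcol).trans ?_
  rw [add_zero]
  congr 1
  funext B C
  rw [crossSum, sum_map_columnRows, Finset.card_filter, Finset.card_filter,
    ← Finset.sum_add_distrib]
  exact Finset.sum_congr rfl fun h _ => sum_attacks_columnRows C h _ _

theorem aeval_X_zero_risePoly (r : ℕ) {ℓ : ℕ} (β : Fin ℓ → ℕ) (m : ℤ) :
    MvPolynomial.aeval ![Polynomial.X, 0] (risePoly r β m) = genPoly r β m opDinv := by
  refine aeval_X_zero_markedPoly
    (bijOn_arrange linked_isRise_and_unmarkedArea_eq_zero_iff r β m) fun π hπ => ?_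
  rw [arrange_runArea_blocksWord hπ.1, totalDinv_flatMap_columnRows hπ.1]

/-! ### Parking functions whose dinv equals their number of marks -/

theorem Row.IsVal.step {x y : Row} (h : x.IsVal y) : x.Step y := by
  simp only [Row.IsVal, Row.Step] at *
  omega

instance : IsTrans Row Row.IsVal :=
  ⟨fun x y z hxy hyz => by simp only [Row.IsVal] at *; omega⟩

/-- Each row is attacked by the least number of lower unmarked rows that `ite_mark_le_attackers`
allows: one if it is marked, and none otherwise. -/
def Tight : List Row → Prop
  | [] => True
  | y :: V => attackers y V = (if y.mark then 1 else 0) ∧ Tight V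

theorem unmarkedDinv_sub_numMarks_eq_zero_iff {V : List Row}
    (hV : Linked (MarkedStep Row.IsVal) Row.IsGround V) :
    unmarkedDinv V - numMarks V = 0 ↔ Tight V := by
  induction V with
  | nil => simp [Tight, unmarkedDinv]
  | cons y V ih =>
    have hy := ite_mark_le_attackers hV
    have hle := numMarks_le_unmarkedDinv hV.tail
    rw [Tight, ← ih hV.tail, unmarkedDinv_cons, numMarks_cons]
    omega

@[simp] theorem attackers_cons (y x : Row) (V : List Row) :
    attackers y (x :: V) = (if x.mark = false ∧ x.Attacks y then 1 else 0) + attackers y V := rfl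

theorem attackers_append_of_marked {A : List Row} (hA : ∀ x ∈ A, x.mark = true) (y : Row)
    (D : List Row) : attackers y (A ++ D) = attackers y D := by
  induction A with
  | nil => rfl
  | cons x A ih =>
    rw [List.forall_mem_cons] at hA
    simp [hA.1, ih hA.2]

theorem tight_append {A : List Row} (hA : ∀ x ∈ A, x.mark = true) {D : List Row} :
    Tight (A ++ D) ↔ (∀ x ∈ A, attackers x D = 1) ∧ Tight D := by
  induction A with
  | nil => simp
  | cons y A ih =>
    rw [List.forall_mem_cons] at hA
    rw [List.cons_append, Tight, ih hA.2, attackers_append_of_marked hA.2, if_pos hA.1,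
      List.forall_mem_cons, and_assoc]

theorem linked_append_cons {A : List Row} (hA : ∀ x ∈ A, x.mark = true) {x : Row} {D : List Row} :
    Linked (MarkedStep Row.IsVal) Row.IsGround (A ++ x :: D) ↔
      (A ++ [x]).Pairwise Row.IsVal ∧ Linked (MarkedStep Row.IsVal) Row.IsGround (x :: D) := by
  rw [← List.isChain_iff_pairwise]
  induction A with
  | nil => simp
  | cons y A ih =>
    rw [List.forall_mem_cons] at hA
    have hstep (z : Row) : MarkedStep Row.IsVal y z ↔ y.IsVal z :=
      ⟨fun h => h.2 hA.1, fun h => ⟨h.step, fun _ => h⟩⟩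
    specialize ih hA.2
    cases A with
    | nil => simp [hstep]
    | cons z A =>
      simp only [List.cons_append, linked_cons_cons, List.isChain_cons_cons, hstep] at ih ⊢
      rw [ih, and_assoc]

/-- The rows of a parking function with marked contractible valleys whose dinv equals its number of
marks, a blank bottom row being allowed. -/
structure TightPF (V : List Row) : Prop where
  linked : Linked (MarkedStep Row.IsVal) Row.IsGround V
  tight : Tight V

theorem tightPF_append_cons {A : List Row} (hA : ∀ x ∈ A, x.mark = true) {x : Row}
    {D : List Row} :
    TightPF (A ++ x :: D) ↔ (A ++ [x]).Pairwise Row.IsVal ∧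
      (∀ y ∈ A, attackers y (x :: D) = 1) ∧ TightPF (x :: D) := by
  constructor
  · rintro ⟨hlinked, htight⟩
    obtain ⟨hpair, hlinked⟩ := (linked_append_cons hA).1 hlinked
    obtain ⟨hatt, htight⟩ := (tight_append hA).1 htight
    exact ⟨hpair, hatt, hlinked, htight⟩
  · rintro ⟨hpair, hatt, hlinked, htight⟩
    exact ⟨(linked_append_cons hA).2 ⟨hpair, hlinked⟩, (tight_append hA).2 ⟨hatt, htight⟩⟩

theorem tightPF_cons_of_unmarked {v : Row} (hv : v.mark = false) {D : List Row} (hD : D ≠ []) :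
    TightPF (v :: D) ↔ (∀ x ∈ D.head?, v.Step x) ∧ attackers v D = 0 ∧ TightPF D := by
  have hstep (x : Row) : MarkedStep Row.IsVal v x ↔ v.Step x := by simp [MarkedStep, hv]
  constructor
  · rintro ⟨hlinked, hatt, htight⟩
    simp only [linked_cons, hstep] at hlinked
    exact ⟨hlinked.1, by simpa [hv] using hatt, hlinked.2.2, htight⟩
  · rintro ⟨hhead, hatt, hlinked, htight⟩
    refine ⟨linked_cons.2 ⟨?_, fun h => absurd h hD, hlinked⟩, by simpa [hv] using hatt, htight⟩
    simpa only [hstep] using hhead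

theorem TightPF.tail {y : Row} {V : List Row} (h : TightPF (y :: V)) : TightPF V :=
  ⟨h.linked.tail, h.tight.2⟩

theorem TightPF.of_append {A D : List Row} (h : TightPF (A ++ D)) : TightPF D := by
  induction A with
  | nil => exact h
  | cons y A ih => exact ih h.tail

theorem TightPF.not_isVal {v : Row} {D : List Row} (h : TightPF (v :: D)) (hv : v.mark = false) :
    ∀ x ∈ D, ¬ v.IsVal x := by
  have hatt : attackers v D = 0 := by simpa [hv] using h.tight.1
  exact fun x hx hval => (attackers_pos h.linked.tail ⟨x, hx, hval⟩).ne' hatt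

theorem attackers_eq_zero_of_not_isVal {y : Row} {V : List Row} (h : ∀ x ∈ V, ¬ y.IsVal x) :
    attackers y V = 0 :=
  attackers_eq_zero.2 fun x hx _ hatt => h x hx (Row.attacks_iff.1 hatt).1

/-! ### The order of the letters of a block in the word of `minimaj` -/

/-- The order, from top to bottom, of the letters of a block written to the left of the letter `l`
in the word of `minimaj`. -/
def BlockLt (l x y : ℕ) : Prop := (x ≤ l ∧ l < y) ∨ ((x ≤ l ↔ y ≤ l) ∧ y < x)

/-- The letters of a block in decreasing order with respect to their position in the word of
`minimaj`, where the block is written to the left of the letter `l`. -/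
def blockLabels (l : ℕ) (B : Finset ℕ) : List ℕ :=
  ({x ∈ B | x ≤ l} : Finset ℕ).sort (· ≥ ·) ++ ({x ∈ B | l < x} : Finset ℕ).sort (· ≥ ·)

theorem pairwise_blockLabels (l : ℕ) (B : Finset ℕ) : (blockLabels l B).Pairwise (BlockLt l) := by
  rw [blockLabels, List.pairwise_append]
  refine ⟨(Finset.sortedGT_sort _).pairwise.imp_of_mem ?_,
    (Finset.sortedGT_sort _).pairwise.imp_of_mem ?_, ?_⟩ <;>
  · simp only [Finset.mem_sort, Finset.mem_filter, BlockLt]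
    omega

theorem coe_blockLabels (l : ℕ) (B : Finset ℕ) : (blockLabels l B : Multiset ℕ) = B.val := by
  rw [blockLabels, ← Multiset.coe_add, Finset.sort_eq, Finset.sort_eq, Finset.filter_val,
    Finset.filter_val]
  simpa only [not_le] using Multiset.filter_add_not (· ≤ l) B.val

theorem reverse_sort_ge (B : Finset ℕ) : (B.sort (· ≥ ·)).reverse = B.sort (· ≤ ·) := by
  refine List.Perm.eq_of_sortedLE ?_ (Finset.sortedLT_sort _).sortedLE ?_
  · exact (List.pairwise_reverse.2 (Finset.sortedGT_sort B).sortedGE.pairwise).sortedLE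
  · rw [← Multiset.coe_eq_coe, Multiset.coe_reverse, Finset.sort_eq, Finset.sort_eq]

theorem reverse_blockLabels (l : ℕ) (B : Finset ℕ) :
    (blockLabels l B).reverse =
      ({x ∈ B | l < x} : Finset ℕ).sort (· ≤ ·) ++ ({x ∈ B | x ≤ l} : Finset ℕ).sort (· ≤ ·) := by
  rw [blockLabels, List.reverse_append, reverse_sort_ge, reverse_sort_ge]

theorem eq_blockLabels_of_pairwise {l : ℕ} {w : List ℕ} (hw : w.Pairwise (BlockLt l)) :
    w = blockLabels l w.toFinset := by
  refine List.Perm.eq_of_pairwise ?_ hw (pairwise_blockLabels _ _) ?_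
  · simp only [BlockLt]
    omega
  · have hnodup : w.Nodup := hw.imp fun h => by
      rintro rfl
      simp only [BlockLt] at h
      omega
    rw [← Multiset.coe_eq_coe, coe_blockLabels, List.toFinset_val, hnodup.dedup]

/-- `N ++ [v]` are the rows, from top to bottom, of the block `B` written to the left of the label
of `u` in the word of `minimaj`; the lowest one is unmarked. -/
structure IsBlock (u : Row) (B : Finset ℕ) (N : List Row) (v : Row) : Prop where
  map_label : (N ++ [v]).map Row.label = blockLabels u.label B
  area_eq : ∀ x ∈ N ++ [v], x.area = ascArea x.label x.mark u
  mark : ∀ x ∈ N, x.mark = true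
  last : v.mark = false

theorem Row.isVal_iff_blockLt {u x y : Row} (hx : x.area = ascArea x.label x.mark u)
    (hy : y.area = ascArea y.label y.mark u) :
    x.IsVal y ↔ BlockLt u.label x.label y.label := by
  simp only [IsVal, BlockLt, hx, hy, ascArea]
  split_ifs <;> omega

theorem exists_isBlock (u : Row) {B : Finset ℕ} (hB : B.Nonempty) : ∃ N v, IsBlock u B N v := by
  let row (m : Bool) (l : ℕ) : Row := ⟨ascArea l m u, l, m⟩
  rcases List.eq_nil_or_concat (blockLabels u.label B) with h | ⟨w, l, h⟩
  · have hcoe := coe_blockLabels u.label B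
    rw [h] at hcoe
    exact absurd (Finset.val_eq_zero.1 hcoe.symm) hB.ne_empty
  · refine ⟨w.map (row true), row false l, ?_, ?_, ?_, rfl⟩
    · simp [h, row, Function.comp_def]
    · simp only [List.mem_append, List.mem_map, List.mem_singleton]
      rintro _ (⟨x, -, rfl⟩ | rfl) <;> rfl
    · simp only [List.mem_map]
      rintro _ ⟨x, -, rfl⟩
      rfl

theorem isBlock_of_pairwise {u v : Row} {N : List Row} (hpair : (N ++ [v]).Pairwise Row.IsVal)
    (harea : ∀ x ∈ N ++ [v], x.area = ascArea x.label x.mark u) (hN : ∀ x ∈ N, x.mark = true)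
    (hv : v.mark = false) : IsBlock u ((N ++ [v]).map Row.label).toFinset N v := by
  refine ⟨eq_blockLabels_of_pairwise (List.pairwise_map.2 (hpair.imp_of_mem ?_)), harea, hN, hv⟩
  exact fun hx hy => (Row.isVal_iff_blockLt (harea _ hx) (harea _ hy)).1

namespace IsBlock

variable {u v : Row} {B : Finset ℕ} {N : List Row}

theorem pairwise (h : IsBlock u B N v) : (N ++ [v]).Pairwise Row.IsVal := by
  have hpair := pairwise_blockLabels u.label B
  rw [← h.map_label, List.pairwise_map] at hpair
  exact hpair.imp_of_mem fun hx hy =>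
    (Row.isVal_iff_blockLt (h.area_eq _ hx) (h.area_eq _ hy)).2

theorem coe_labels (h : IsBlock u B N v) : ((N ++ [v]).map Row.label : Multiset ℕ) = B.val := by
  rw [h.map_label, coe_blockLabels]

theorem eq_block {B' : Finset ℕ} (h : IsBlock u B N v) (h' : IsBlock u B' N v) : B = B' :=
  Finset.val_injective (h.coe_labels.symm.trans h'.coe_labels)

theorem nonempty (h : IsBlock u B N v) : B.Nonempty := by
  rw [Finset.nonempty_iff_ne_empty]
  rintro rfl
  simpa using h.coe_labels

theorem rows_eq_map (h : IsBlock u B N v) :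
    N = (N.map Row.label).map (fun l => ⟨ascArea l true u, l, true⟩) := by
  rw [List.map_map]
  conv_lhs => rw [← List.map_id N]
  refine List.map_congr_left fun x hx => Row.ext ?_ rfl (h.mark x hx)
  simp [h.area_eq x (List.mem_append_left _ hx), h.mark x hx]

theorem last_eq (h : IsBlock u B N v) : v = ⟨ascArea v.label false u, v.label, false⟩ :=
  Row.ext (by rw [h.area_eq v (by simp), h.last]) rfl h.last

theorem eq_rows {N' : List Row} {v' : Row} (h : IsBlock u B N v) (h' : IsBlock u B N' v') :
    N = N' ∧ v = v' := by
  have hlabels := h.map_label.trans h'.map_label.symm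
  rw [List.map_append, List.map_append] at hlabels
  obtain ⟨hN, hv⟩ := List.append_inj' hlabels rfl
  rw [h.rows_eq_map, h'.rows_eq_map, h.last_eq, h'.last_eq, hN, List.singleton_inj.1 hv]
  exact ⟨rfl, rfl⟩

theorem step (h : IsBlock u B N v) {x : Row} (hx : x ∈ N ++ [v]) : x.Step u :=
  (Row.area_eq_ascArea_iff.1 (h.area_eq x hx)).2

theorem not_isVal (h : IsBlock u B N v) {x : Row} (hx : x ∈ N ++ [v]) : ¬ x.IsVal u :=
  (Row.area_eq_ascArea_iff.1 (h.area_eq x hx)).1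

end IsBlock

/-! ### Major indices of words as sums of areas -/

theorem wordMaj_eq_descSum (w : List ℕ) : wordMaj w = descSum (w.zip (List.range w.length)) := by
  rw [descSum_zip (by simp), wordMaj]
  refine Finset.sum_congr rfl fun i hi => ?_
  have hi : i + 1 < w.length := by
    have := Finset.mem_range.1 hi
    omega
  rw [List.getD_eq_getElem (List.range w.length) 0 (by simpa using hi), List.getElem_range]

theorem wordMaj_cons (x : ℕ) (w : List ℕ) : wordMaj (x :: w) = desc (x :: w) + wordMaj w := by
  have hhead : ∀ y ∈ (w.zip (List.range w.length)).head?, y.2 = 0 := by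
    cases w <;> simp [List.range_succ_eq_map]
  have hsucc := descSum_cons_map_succ hhead (x, 0)
  rw [List.map_fst_zip (by simp)] at hsucc
  rw [wordMaj_eq_descSum, wordMaj_eq_descSum, ← hsucc, List.length_cons, List.range_succ_eq_map,
    List.zip_cons_cons, List.zip_map_right]
  rfl

theorem area_eq_desc_and_totalArea_add_wordMaj {S : List Row} {u : Row} {w : List ℕ}
    (hS : (S ++ [u]).IsChain fun y x => y.area = ascArea y.label y.mark x)
    (hu : u.area = desc (u.label :: w)) :
    (∀ y ∈ (S ++ [u]).head?, y.area = desc (S.map Row.label ++ u.label :: w)) ∧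
      wordMaj (S.map Row.label ++ u.label :: w) = totalArea S + wordMaj (u.label :: w) := by
  induction S with
  | nil => simpa [totalArea] using hu
  | cons y S ih =>
    obtain ⟨x, L, hx⟩ := List.exists_cons_of_ne_nil (show S ++ [u] ≠ [] by simp)
    obtain ⟨l, hl⟩ : ∃ l, S.map Row.label ++ u.label :: w = x.label :: l := by
      cases S <;> simp_all
    rw [List.cons_append, hx, List.isChain_cons_cons] at hS
    obtain ⟨hhead, hmaj⟩ := ih (hx ▸ hS.2)
    have hy : y.area = desc (y.label :: (S.map Row.label ++ u.label :: w)) := by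
      rw [hx, hl] at hhead
      rw [hS.1, ascArea, hl, desc_cons_cons, ← hhead x rfl]
      split_ifs <;> omega
    refine ⟨by simpa using hy, ?_⟩
    rw [List.map_cons, List.cons_append, wordMaj_cons, hmaj, ← hy, totalArea_cons, add_assoc]

/-! ### Inserting the rows of a block -/

theorem append_inj_of_forall {α : Type*} {p : α → Prop} {A A' D D' : List α}
    (hA : ∀ x ∈ A, p x) (hA' : ∀ x ∈ A', p x) (hD : ∀ x ∈ D.head?, ¬ p x)
    (hD' : ∀ x ∈ D'.head?, ¬ p x) (h : A ++ D = A' ++ D') : A = A' ∧ D = D' := by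
  induction A generalizing A' with
  | nil =>
    cases A' with
    | nil => exact ⟨rfl, h⟩
    | cons y A' =>
      rw [List.nil_append] at h
      exact absurd (hA' y (by simp)) (hD y (by simp [h]))
  | cons y A ih =>
    cases A' with
    | nil =>
      rw [List.nil_append] at h
      exact absurd (hA y (by simp)) (hD' y (by simp [← h]))
    | cons y' A' =>
      rw [List.forall_mem_cons] at hA hA'
      rw [List.cons_append, List.cons_append, List.cons.injEq] at h
      obtain ⟨rfl, h⟩ := h
      obtain ⟨rfl, rfl⟩ := ih hA.2 hA'.2 h
      exact ⟨rfl, rfl⟩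

theorem exists_append_of_pairwise {α : Type*} {s : α → α → Prop} {p : α → Prop} {W : List α}
    (hW : W.Pairwise s) (hp : ∀ x y, s x y → p y → p x) :
    ∃ T N, W = T ++ N ∧ (∀ x ∈ T, p x) ∧ ∀ x ∈ N, ¬ p x := by
  induction hW with
  | nil => exact ⟨[], [], by simp⟩
  | @cons y W hy _ ih =>
    by_cases hpy : p y
    · obtain ⟨T, N, rfl, hT, hN⟩ := ih
      exact ⟨y :: T, N, rfl, List.forall_mem_cons.2 ⟨hpy, hT⟩, hN⟩
    · exact ⟨[], y :: W, rfl, by simp,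
        List.forall_mem_cons.2 ⟨hpy, fun x hx hpx => hpy (hp y x (hy x hx) hpx)⟩⟩

theorem find?_unmarked_eq_some_iff {V : List Row} {u : Row} :
    V.find? (fun x => !x.mark) = some u ↔
      ∃ T R, V = T ++ u :: R ∧ (∀ x ∈ T, x.mark = true) ∧ u.mark = false := by
  rw [List.find?_eq_some_iff_append]
  simp only [Bool.not_eq_true', Bool.not_not, ← exists_and_left]
  exact exists₂_congr fun T R => by tauto

theorem exists_eq_append_unmarked {V : List Row} (h : ∃ x ∈ V, x.mark = false) :
    ∃ T u R, V = T ++ u :: R ∧ (∀ x ∈ T, x.mark = true) ∧ u.mark = false := by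
  obtain ⟨u, hu⟩ := Option.isSome_iff_exists.1
    (List.find?_isSome.2 (by simpa using h) : (V.find? fun x => !x.mark).isSome)
  obtain ⟨T, R, hV⟩ := find?_unmarked_eq_some_iff.1 hu
  exact ⟨T, u, R, hV⟩

namespace Row

variable {u v x y : Row}

theorem Step.of_not_isVal (hvu : v.Step u) (hxu : ¬ x.IsVal u) : v.Step x := by
  simp only [IsVal, Step] at *
  omega

theorem isVal_of_not_step (hx : ¬ v.Step x) (hy : v.Step y) : x.IsVal y := by
  simp only [IsVal, Step] at *
  omega

theorem IsVal.of_not_isVal (hxu : x.IsVal u) (hyu : ¬ y.IsVal u) : x.IsVal y := by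
  simp only [IsVal] at *
  omega

theorem IsVal.asymm (hxy : x.IsVal y) : ¬ y.IsVal x := by
  simp only [IsVal] at *
  omega

theorem IsVal.trans_step (hxv : x.IsVal v) (hvu : v.Step u) : x.Step u := by
  simp only [IsVal, Step] at *
  omega

end Row

/-- `V'` arises from `V` by inserting the rows of the block `B`, the lowest one being `v`, where `u`
is the first unmarked row of `V`. The new rows are put as low as possible above `u`: below the
marked rows which may not be placed directly below `v`. -/
def Insertion (B : Finset ℕ) (u : Row) (V : List Row) (v : Row) (V' : List Row) : Prop :=
  ∃ T T' N R, V = T ++ (T' ++ u :: R) ∧ V' = T ++ (N ++ v :: (T' ++ u :: R)) ∧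
    (∀ x ∈ T, x.mark = true ∧ ¬ v.Step x) ∧ (∀ x ∈ T', x.mark = true ∧ v.Step x) ∧
    u.mark = false ∧ IsBlock u B N v

theorem tightPF_append_append_cons {A A' : List Row} (hA : ∀ x ∈ A, x.mark = true)
    (hA' : ∀ x ∈ A', x.mark = true) {u : Row} {R : List Row} :
    TightPF (A ++ (A' ++ u :: R)) ↔ (A.Pairwise Row.IsVal ∧ (A' ++ [u]).Pairwise Row.IsVal ∧
        ∀ x ∈ A, ∀ y ∈ A' ++ [u], x.IsVal y) ∧
      (∀ x ∈ A, attackers x (u :: R) = 1) ∧ (∀ x ∈ A', attackers x (u :: R) = 1) ∧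
        TightPF (u :: R) := by
  have hmark : ∀ x ∈ A ++ A', x.mark = true := by
    simpa [or_imp, forall_and] using ⟨hA, hA'⟩
  rw [← List.append_assoc, tightPF_append_cons hmark, List.append_assoc, List.pairwise_append,
    List.forall_mem_append, and_assoc]
  simp only [and_assoc]

theorem TightPF.insertion {B : Finset ℕ} {u v : Row} {V V' : List Row} (h : TightPF V)
    (hV : Insertion B u V v V') : TightPF V' := by
  obtain ⟨T, T', N, R, rfl, rfl, hT, hT', hu, hB⟩ := hV
  have hmarkT : ∀ x ∈ T, x.mark = true := fun x hx => (hT x hx).1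
  have hmarkT' : ∀ x ∈ T', x.mark = true := fun x hx => (hT' x hx).1
  have hD : TightPF (T' ++ u :: R) := h.of_append
  obtain ⟨⟨hpairT, -, hval⟩, hattT, -, huR⟩ := (tightPF_append_append_cons hmarkT hmarkT').1 h
  have hatt : ∀ x ∈ N ++ [v], attackers x (T' ++ u :: R) = 0 := fun x hx => by
    rw [attackers_append_of_marked hmarkT']
    refine attackers_eq_zero_of_not_isVal (List.forall_mem_cons.2 ⟨hB.not_isVal hx, fun y hy => ?_⟩)
    exact Row.not_isVal_trans (hB.not_isVal hx) (huR.not_isVal hu y hy)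
  refine (tightPF_append_append_cons hmarkT hB.mark).2
    ⟨⟨hpairT, hB.pairwise, fun x hx y hy => ?_⟩, fun x hx => ?_, fun x hx => ?_, ?_⟩
  · exact (hval x hx u (by simp)).of_not_isVal (hB.not_isVal hy)
  · rw [attackers_cons, attackers_append_of_marked hmarkT', hattT x hx,
      if_neg fun hv => (hT x hx).2 (Row.attacks_iff.1 hv.2).2]
  · have hxv : x.IsVal v := (List.pairwise_append.1 hB.pairwise).2.2 x hx v (by simp)
    have hvx : v.Step x := (hB.step (by simp)).of_not_isVal (hB.not_isVal (by simp [hx]))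
    rw [attackers_cons, hatt x (by simp [hx]), if_pos ⟨hB.last, Row.attacks_iff.2 ⟨hxv, hvx⟩⟩]
  · refine (tightPF_cons_of_unmarked hB.last (by simp)).2 ⟨?_, hatt v (by simp), hD⟩
    cases T' with
    | nil => simpa using hB.step (x := v) (by simp)
    | cons z T' => simpa using (hT' z (by simp)).2

theorem exists_insertion {B : Finset ℕ} (hB : B.Nonempty) {u : Row} {T R : List Row}
    (h : TightPF (T ++ u :: R)) (hT : ∀ x ∈ T, x.mark = true) (hu : u.mark = false) :
    ∃ v V', Insertion B u (T ++ u :: R) v V' := by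
  obtain ⟨N, v, hN⟩ := exists_isBlock u hB
  have hpair : T.Pairwise Row.IsVal :=
    (List.pairwise_append.1 ((tightPF_append_cons hT).1 h).1).1
  obtain ⟨T, T', rfl, hnot, hstep⟩ := exists_append_of_pairwise (p := fun x => ¬ v.Step x) hpair
    fun x y hxy hy hx => hy (hx.of_not_isVal hxy.asymm)
  rw [List.forall_mem_append] at hT
  exact ⟨v, _, T, T', N, R, List.append_assoc .., rfl, fun x hx => ⟨hT.1 x hx, hnot x hx⟩,
    fun x hx => ⟨hT.2 x hx, not_not.1 (hstep x hx)⟩, hu, hN⟩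

theorem Insertion.right_unique {B : Finset ℕ} {u v v₁ : Row} {V V' V₁ : List Row}
    (h : Insertion B u V v V') (h₁ : Insertion B u V v₁ V₁) : v = v₁ ∧ V' = V₁ := by
  obtain ⟨T, T', N, R, rfl, rfl, hT, hT', hu, hB⟩ := h
  obtain ⟨T₁, T₁', N₁, R₁, hV, rfl, hT₁, hT₁', -, hB₁⟩ := h₁
  obtain ⟨rfl, rfl⟩ := hB.eq_rows hB₁
  rw [← List.append_assoc, ← List.append_assoc] at hV
  obtain ⟨hTT, hR⟩ := append_inj_of_forall (p := fun x => x.mark = true)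
    (List.forall_mem_append.2 ⟨fun x hx => (hT x hx).1, fun x hx => (hT' x hx).1⟩)
    (List.forall_mem_append.2 ⟨fun x hx => (hT₁ x hx).1, fun x hx => (hT₁' x hx).1⟩)
    (by simp [hu]) (by simp [hu]) hV
  obtain ⟨rfl, rfl⟩ := append_inj_of_forall (p := fun x => ¬ v.Step x)
    (fun x hx => (hT x hx).2) (fun x hx => (hT₁ x hx).2)
    (fun x hx => not_not.2 (hT' x (List.mem_of_mem_head? hx)).2)
    (fun x hx => not_not.2 (hT₁' x (List.mem_of_mem_head? hx)).2) hTT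
  rw [(List.cons.inj hR).2]
  exact ⟨rfl, rfl⟩

theorem Insertion.left_unique {B B₁ : Finset ℕ} {u u₁ v v₁ : Row} {V V' V₁ : List Row}
    (h : Insertion B u V v V') (h₁ : Insertion B₁ u₁ V₁ v₁ V') (hV : TightPF V)
    (hV₁ : TightPF V₁) : B = B₁ ∧ u = u₁ ∧ V = V₁ := by
  obtain ⟨T, T', N, R, rfl, rfl, hT, hT', hu, hB⟩ := h
  obtain ⟨T₁, T₁', N₁, R₁, rfl, hV', hT₁, hT₁', hu₁, hB₁⟩ := h₁
  rw [← List.append_assoc, ← List.append_assoc] at hV'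
  obtain ⟨hTN, hvD⟩ := append_inj_of_forall (p := fun x => x.mark = true)
    (List.forall_mem_append.2 ⟨fun x hx => (hT x hx).1, hB.mark⟩)
    (List.forall_mem_append.2 ⟨fun x hx => (hT₁ x hx).1, hB₁.mark⟩)
    (by simp [hB.last]) (by simp [hB₁.last]) hV'
  obtain ⟨rfl, hD⟩ := List.cons.inj hvD
  obtain ⟨rfl, hR⟩ := append_inj_of_forall (p := fun x => x.mark = true)
    (fun x hx => (hT' x hx).1) (fun x hx => (hT₁' x hx).1) (by simp [hu]) (by simp [hu₁]) hD
  obtain ⟨rfl, rfl⟩ := List.cons.inj hR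
  have hval {T : List Row} (hV : TightPF (T ++ (T' ++ u :: R)))
      (hT : ∀ x ∈ T, x.mark = true ∧ ¬ v.Step x) : ∀ x ∈ T, x.IsVal u := fun x hx =>
    ((tightPF_append_append_cons (fun x hx => (hT x hx).1) fun x hx => (hT' x hx).1).1
      hV).1.2.2 x hx u (by simp)
  obtain ⟨rfl, rfl⟩ := append_inj_of_forall (p := fun x => x.IsVal u) (hval hV hT) (hval hV₁ hT₁)
    (fun x hx => hB.not_isVal (List.mem_append_left _ (List.mem_of_mem_head? hx)))
    (fun x hx => hB₁.not_isVal (List.mem_append_left _ (List.mem_of_mem_head? hx))) hTN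
  exact ⟨hB.eq_block hB₁, rfl, rfl⟩

theorem TightPF.step_of_append {v u : Row} {T R : List Row} (h : TightPF (v :: (T ++ u :: R)))
    (hv : v.mark = false) (hT : ∀ x ∈ T, x.mark = true) : ∀ x ∈ T ++ [u], v.Step x := by
  obtain ⟨hhead, -, hTu⟩ := (tightPF_cons_of_unmarked hv (by simp)).1 h
  have hpair := ((tightPF_append_cons hT).1 hTu).1
  cases T with
  | nil => simpa using hhead
  | cons z T =>
    have hz : v.Step z := by simpa using hhead
    rw [List.cons_append, List.pairwise_cons] at hpair
    exact List.forall_mem_cons.2 ⟨hz, fun x hx => hz.of_not_isVal (hpair.1 x hx).asymm⟩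

theorem TightPF.area_eq_ascArea {N D : List Row} {v u : Row} (h : TightPF (N ++ v :: D))
    (hN : ∀ x ∈ N, x.mark = true ∧ v.Step x) (hv : v.mark = false) (hu : u ∈ D)
    (hvu : v.Step u) : ∀ x ∈ N ++ [v], x.area = ascArea x.label x.mark u := by
  obtain ⟨hpair, hatt, hvD⟩ := (tightPF_append_cons fun x hx => (hN x hx).1).1 h
  refine List.forall_mem_append.2 ⟨fun x hx => ?_, List.forall_mem_singleton.2 ?_⟩
  · have hxv : x.IsVal v := (List.pairwise_append.1 hpair).2.2 x hx v (by simp)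
    have hzero : attackers x D = 0 := by
      simpa [hv, Row.attacks_iff.2 ⟨hxv, (hN x hx).2⟩] using hatt x hx
    exact Row.area_eq_ascArea_iff.2
      ⟨fun hxu => (attackers_pos hvD.tail.linked ⟨u, hu, hxu⟩).ne' hzero, hxv.trans_step hvu⟩
  · exact Row.area_eq_ascArea_iff.2 ⟨hvD.not_isVal hv u hu, hvu⟩

theorem TightPF.remove {T T' N R : List Row} {u v : Row}
    (h : TightPF (T ++ (N ++ v :: (T' ++ u :: R)))) (hT : ∀ x ∈ T, x.mark = true ∧ ¬ v.Step x)
    (hN : ∀ x ∈ N, x.mark = true) (hT' : ∀ x ∈ T', x.mark = true)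
    (hstep : ∀ x ∈ T' ++ [u], v.Step x) : TightPF (T ++ (T' ++ u :: R)) := by
  have hmarkT : ∀ x ∈ T, x.mark = true := fun x hx => (hT x hx).1
  obtain ⟨⟨hpairT, -⟩, hattT, -, hvD⟩ := (tightPF_append_append_cons hmarkT hN).1 h
  obtain ⟨hpair, hatt, huR⟩ := (tightPF_append_cons hT').1 hvD.tail
  refine (tightPF_append_append_cons hmarkT hT').2 ⟨⟨hpairT, hpair, fun x hx y hy =>
    Row.isVal_of_not_step (hT x hx).2 (hstep y hy)⟩, fun x hx => ?_, hatt, huR⟩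
  have hxv : ¬ v.Attacks x := fun hatt => (hT x hx).2 (Row.attacks_iff.1 hatt).2
  simpa [hxv, attackers_append_of_marked hT'] using hattT x hx

theorem TightPF.exists_insertion {W D : List Row} {v : Row} (h : TightPF (W ++ v :: D))
    (hW : ∀ x ∈ W, x.mark = true) (hv : v.mark = false) (hD : ∃ x ∈ D, x.mark = false) :
    ∃ B u V, Insertion B u V v (W ++ v :: D) ∧ TightPF V := by
  obtain ⟨hpair, -, hvD⟩ := (tightPF_append_cons hW).1 h
  obtain ⟨T', u, R, rfl, hT', hu⟩ := exists_eq_append_unmarked hD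
  have hstep := hvD.step_of_append hv hT'
  obtain ⟨T, N, rfl, hnot, hN⟩ := exists_append_of_pairwise (p := fun x => ¬ v.Step x)
    (List.pairwise_append.1 hpair).1 fun x y hxy hy hx => hy (hx.of_not_isVal hxy.asymm)
  simp only [not_not] at hN
  rw [List.append_assoc] at h hpair ⊢
  rw [List.forall_mem_append] at hW
  have hT : ∀ x ∈ T, x.mark = true ∧ ¬ v.Step x := fun x hx => ⟨hW.1 x hx, hnot x hx⟩
  have hB := isBlock_of_pairwise (List.pairwise_append.1 hpair).2.1
    (h.of_append.area_eq_ascArea (fun x hx => ⟨hW.2 x hx, hN x hx⟩) hv (by simp)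
      (hstep u (by simp))) hW.2 hv
  exact ⟨_, u, _, ⟨T, T', N, R, rfl, rfl, hT,
    fun x hx => ⟨hT' x hx, hstep x (List.mem_append_left _ hx)⟩, hu, hB⟩,
    h.remove hT hW.2 hT' hstep⟩

/-! ### Parking functions of dinv zero, and `minimaj` -/

theorem IsBlock.isChain_reverse {B : Finset ℕ} {N : List Row} {u v : Row} (h : IsBlock u B N v) :
    ((N ++ [v]).reverse ++ [u]).IsChain fun y x => y.area = ascArea y.label y.mark x := by
  rw [← List.reverse_cons, List.isChain_reverse]
  refine (List.pairwise_cons.2 ⟨h.area_eq, h.pairwise.imp_of_mem fun {x y} hx hy hxy => ?_⟩).isChain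
  have hx := h.area_eq x hx
  have hy := h.area_eq y hy
  simp only [Row.IsVal, ascArea] at *
  split_ifs at * <;> omega

theorem le_of_mem_miniword {L : ℕ} {π : List (Finset ℕ)} (hπ : ∀ B ∈ π, ∀ x ∈ B, x < L) :
    ∀ x ∈ miniword π, x ≤ L := by
  induction π with
  | nil => simp [miniword]
  | cons B π ih =>
    rw [List.forall_mem_cons] at hπ
    have ih := ih hπ.2
    intro x hx
    rw [miniword] at hx
    split at hx
    · exact (hπ.1 x ((Finset.mem_sort _).1 hx)).le
    · next a w hw =>
      rw [List.append_assoc, List.mem_append, List.mem_append, Finset.mem_sort, Finset.mem_sort,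
        Finset.mem_filter, Finset.mem_filter, ← hw] at hx
      rcases hx with hx | hx | hx
      · exact (hπ.1 x hx.1).le
      · exact (hπ.1 x hx.1).le
      · exact ih x hx

theorem desc_append_singleton {L : ℕ} {w : List ℕ} (hw : ∀ x ∈ w, x ≤ L) :
    desc (w ++ [L]) = desc w := by
  induction w with
  | nil => rfl
  | cons x w ih =>
    rw [List.forall_mem_cons] at hw
    specialize ih hw.2
    cases w with
    | nil => simp [desc, descSum, hw.1]
    | cons y w => simpa using ih

theorem wordMaj_append_singleton {L : ℕ} {w : List ℕ} (hw : ∀ x ∈ w, x ≤ L) :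
    wordMaj (w ++ [L]) = wordMaj w := by
  induction w with
  | nil => rfl
  | cons x w ih =>
    rw [List.cons_append, wordMaj_cons, wordMaj_cons, ih (List.forall_mem_cons.1 hw).2,
      ← List.cons_append, desc_append_singleton hw]

theorem miniword_cons_append_singleton {L l : ℕ} {B : Finset ℕ} (hB : ∀ x ∈ B, x < L)
    {π : List (Finset ℕ)} {w : List ℕ} (hw : miniword π ++ [L] = l :: w) :
    miniword (B :: π) ++ [L] = (blockLabels l B).reverse ++ l :: w := by
  rw [reverse_blockLabels, ← hw, miniword]
  cases hπ : miniword π with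
  | nil =>
    obtain rfl : L = l := by simpa [hπ] using congrArg List.head? hw
    rw [Finset.filter_false_of_mem fun x hx => (hB x hx).not_gt,
      Finset.filter_true_of_mem fun x hx => (hB x hx).le]
    simp
  | cons a v =>
    obtain rfl : a = l := by simpa [hπ] using congrArg List.head? hw
    simp

/-- The auxiliary bottom row added to a parking function whose labels are less than `L`. It plays
the role of the row below the last block. -/
def sentinel (L : ℕ) : Row := ⟨0, L, false⟩

/-- `V` is the list of rows obtained from the auxiliary bottom row by inserting the blocks of `π`
from right to left, and `u` is its first unmarked row. -/
inductive Build (L : ℕ) : List (Finset ℕ) → Row → List Row → Prop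
  | nil : Build L [] (sentinel L) [sentinel L]
  | cons {B π u V v V'} : Build L π u V → Insertion B u V v V' → Build L (B :: π) v V'

namespace Insertion

variable {B : Finset ℕ} {u v : Row} {V V' : List Row}

theorem find?_unmarked_left (h : Insertion B u V v V') :
    V.find? (fun x => !x.mark) = some u := by
  obtain ⟨T, T', N, R, rfl, rfl, hT, hT', hu, -⟩ := h
  exact find?_unmarked_eq_some_iff.2 ⟨T ++ T', R, by simp, List.forall_mem_append.2
    ⟨fun x hx => (hT x hx).1, fun x hx => (hT' x hx).1⟩, hu⟩

theorem find?_unmarked_right (h : Insertion B u V v V') :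
    V'.find? (fun x => !x.mark) = some v := by
  obtain ⟨T, T', N, R, rfl, rfl, hT, -, -, hB⟩ := h
  exact find?_unmarked_eq_some_iff.2 ⟨T ++ N, T' ++ u :: R, by simp, List.forall_mem_append.2
    ⟨fun x hx => (hT x hx).1, hB.mark⟩, hB.last⟩

theorem getLast? (h : Insertion B u V v V') : V'.getLast? = V.getLast? := by
  obtain ⟨T, T', N, R, rfl, rfl, -⟩ := h
  simp [List.getLast?_append, List.getLast?_cons]

theorem exists_isBlock (h : Insertion B u V v V') :
    ∃ N, IsBlock u B N v ∧ List.Perm V' ((N ++ [v]) ++ V) := by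
  obtain ⟨T, T', N, R, rfl, rfl, -, -, -, hB⟩ := h
  exact ⟨N, hB, by simpa using List.perm_append_comm_assoc T (N ++ [v]) (T' ++ u :: R)⟩

theorem coe_labels (h : Insertion B u V v V') :
    (V'.map Row.label : Multiset ℕ) = B.val + (V.map Row.label : Multiset ℕ) := by
  obtain ⟨N, hB, hperm⟩ := h.exists_isBlock
  rw [Multiset.coe_eq_coe.2 (hperm.map _), List.map_append, ← Multiset.coe_add, hB.coe_labels]

theorem length_add_numMarks (h : Insertion B u V v V') :
    V'.length + numMarks V = V.length + numMarks V' + 1 := by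
  obtain ⟨N, hB, hperm⟩ := h.exists_isBlock
  have hN : numMarks N = N.length := List.countP_eq_length.2 hB.mark
  have hV' : numMarks V' = numMarks ((N ++ [v]) ++ V) := hperm.countP_eq _
  rw [hperm.length_eq, hV']
  simp only [numMarks, List.countP_append, List.countP_singleton, hB.last, List.length_append,
    List.length_singleton, Bool.false_eq_true, if_false] at hN ⊢
  rw [hN]
  omega

theorem getLast?_of_sentinel {s : Row} (h : Insertion B u (V ++ [s]) v (V' ++ [s])) (hu : u ≠ s) :
    V'.getLast? = V.getLast? := by
  obtain ⟨T, T', N, R, hV, hV', -⟩ := h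
  rcases List.eq_nil_or_concat R with rfl | ⟨R, x, rfl⟩
  · rw [← List.append_assoc] at hV
    exact absurd (List.singleton_inj.1 (List.append_inj' hV rfl).2).symm hu
  · have hV : V ++ [s] = (T ++ T' ++ u :: R) ++ [x] := by simpa using hV
    have hV' : V' ++ [s] = (T ++ N ++ v :: (T' ++ u :: R)) ++ [x] := by simpa using hV'
    rw [(List.append_inj' hV rfl).1, (List.append_inj' hV' rfl).1]
    simp [List.getLast?_append, List.getLast?_cons]

end Insertion

namespace Build

variable {L : ℕ} {π π' : List (Finset ℕ)} {u u' : Row} {V V' : List Row}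

theorem tightPF (h : Build L π u V) : TightPF V := by
  induction h with
  | nil => exact ⟨by simp [sentinel, Row.IsGround], by simp [sentinel, Tight, attackers]⟩
  | cons _ hins ih => exact ih.insertion hins

theorem find?_unmarked (h : Build L π u V) : V.find? (fun x => !x.mark) = some u := by
  cases h with
  | nil => rfl
  | cons _ hins => exact hins.find?_unmarked_right

theorem getLast? (h : Build L π u V) : V.getLast? = some (sentinel L) := by
  induction h with
  | nil => rfl
  | cons _ hins ih => rw [hins.getLast?, ih]

theorem nonempty (h : Build L π u V) : ∀ B ∈ π, B.Nonempty := by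
  induction h with
  | nil => simp
  | cons _ hins ih =>
    obtain ⟨N, hB, -⟩ := hins.exists_isBlock
    exact List.forall_mem_cons.2 ⟨hB.nonempty, ih⟩

theorem coe_labels (h : Build L π u V) :
    (V.map Row.label : Multiset ℕ) = (π.map Finset.val).sum + {L} := by
  induction h with
  | nil => rfl
  | cons _ hins ih => rw [hins.coe_labels, ih, List.map_cons, List.sum_cons, add_assoc]

theorem length_eq (h : Build L π u V) : V.length = numMarks V + π.length + 1 := by
  induction h with
  | nil => rfl
  | cons _ hins ih =>
    have hlen := hins.length_add_numMarks
    rw [List.length_cons]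
    omega

theorem label_lt {B : Finset ℕ} (h : Build L (B :: π) u V) (hB : ∀ x ∈ B, x < L) :
    u.label < L := by
  cases h with
  | cons _ hins =>
    obtain ⟨N, hblock, -⟩ := hins.exists_isBlock
    refine hB _ (show u.label ∈ B.val from ?_)
    simp [← hblock.coe_labels]

theorem exists_miniword_append_singleton_eq (h : Build L π u V) (hπ : ∀ B ∈ π, ∀ x ∈ B, x < L) :
    ∃ w, miniword π ++ [L] = u.label :: w ∧ u.area = desc (u.label :: w) ∧
      totalArea V = wordMaj (u.label :: w) := by
  induction h with
  | nil => exact ⟨[], rfl, rfl, rfl⟩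
  | @cons B π u V v V' _ hins ih =>
    rw [List.forall_mem_cons] at hπ
    obtain ⟨w, hw, harea, hmaj⟩ := ih hπ.2
    obtain ⟨N, hB, hperm⟩ := hins.exists_isBlock
    have hlabels : (N ++ [v]).reverse.map Row.label = (blockLabels u.label B).reverse := by
      rw [List.map_reverse, hB.map_label]
    obtain ⟨hv, hsum⟩ := area_eq_desc_and_totalArea_add_wordMaj hB.isChain_reverse harea
    rw [hlabels, ← miniword_cons_append_singleton hπ.1 hw] at hv hsum
    have hmini : miniword (B :: π) ++ [L] =
        v.label :: (N.reverse.map Row.label ++ u.label :: w) := by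
      rw [miniword_cons_append_singleton hπ.1 hw, ← hlabels]
      simp
    have htotal : totalArea V' = totalArea (N ++ [v]).reverse + totalArea V := by
      rw [totalArea, (hperm.map Row.area).sum_eq]
      simp [totalArea, add_assoc, add_left_comm]
    rw [← hmaj, ← htotal] at hsum
    exact ⟨_, hmini, hmini ▸ hv v (by simp), hmini ▸ hsum.symm⟩

theorem totalArea_eq_minimaj (h : Build L π u V) (hπ : ∀ B ∈ π, ∀ x ∈ B, x < L) :
    totalArea V = minimaj π := by
  obtain ⟨w, hw, -, hmaj⟩ := h.exists_miniword_append_singleton_eq hπ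
  rw [hmaj, ← hw, wordMaj_append_singleton (le_of_mem_miniword hπ), minimaj]

theorem right_unique (h : Build L π u V) (h' : Build L π u' V') : u = u' ∧ V = V' := by
  induction h generalizing u' V' with
  | nil =>
    cases h'
    exact ⟨rfl, rfl⟩
  | cons _ hins ih =>
    obtain - | ⟨hbuild, hins'⟩ := h'
    obtain ⟨rfl, rfl⟩ := ih hbuild
    exact hins.right_unique hins'

theorem left_unique (h : Build L π u V) (h' : Build L π' u' V) : π = π' := by
  induction h generalizing π' u' with
  | nil =>
    cases π' with
    | nil => rfl
    | cons B π' => simpa [numMarks, sentinel] using h'.length_eq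
  | cons hbuild hins ih =>
    cases h' with
    | nil => simpa [numMarks, sentinel] using (hbuild.cons hins).length_eq
    | cons hbuild' hins' =>
      obtain rfl := Option.some_injective _
        (hins.find?_unmarked_right.symm.trans hins'.find?_unmarked_right)
      obtain ⟨rfl, rfl, rfl⟩ := hins.left_unique hins' hbuild.tightPF hbuild'.tightPF
      rw [ih hbuild']

end Build

theorem exists_build (L : ℕ) {π : List (Finset ℕ)} (hπ : ∀ B ∈ π, B.Nonempty) :
    ∃ u V, Build L π u V := by
  induction π with
  | nil => exact ⟨_, _, .nil⟩
  | cons B π ih =>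
    rw [List.forall_mem_cons] at hπ
    obtain ⟨u, V, h⟩ := ih hπ.2
    obtain ⟨T, R, rfl, hT, hu⟩ := find?_unmarked_eq_some_iff.1 h.find?_unmarked
    obtain ⟨v, V', hins⟩ := exists_insertion hπ.1 h.tightPF hT hu
    exact ⟨v, V', h.cons hins⟩

theorem TightPF.eq_nil_of_marked {L : ℕ} {W : List Row} (h : TightPF (W ++ [sentinel L]))
    (hW : ∀ x ∈ W, x.mark = true) (hlabel : ∀ x ∈ W, x.label ≤ L) : W = [] := by
  refine List.eq_nil_iff_forall_not_mem.2 fun x hx => ?_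
  have hval : x.IsVal (sentinel L) :=
    (List.pairwise_append.1 ((tightPF_append_cons hW).1 h).1).2.2 x hx _ (by simp)
  have hle := hlabel x hx
  simp only [Row.IsVal, sentinel] at hval
  omega

theorem TightPF.exists_build {L : ℕ} {V : List Row} (h : TightPF V)
    (hlast : V.getLast? = some (sentinel L)) (hlabel : ∀ x ∈ V, x.label ≤ L) :
    ∃ π u, Build L π u V := by
  induction hn : V.length using Nat.strong_induction_on generalizing V with
  | _ n ih =>
    obtain ⟨W, v, D, rfl, hW, hv⟩ := exists_eq_append_unmarked ⟨_, List.mem_of_getLast? hlast, rfl⟩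
    cases D with
    | nil =>
      obtain rfl : v = sentinel L := by simpa using hlast
      rw [h.eq_nil_of_marked hW fun x hx => hlabel x (by simp [hx])]
      exact ⟨_, _, .nil⟩
    | cons x D =>
      have hD : sentinel L ∈ x :: D := List.mem_of_getLast? (by
        simpa [List.getLast?_append, List.getLast?_cons] using hlast)
      obtain ⟨B, u, V, hins, hV⟩ := h.exists_insertion hW hv ⟨_, hD, rfl⟩
      obtain ⟨N, -, hperm⟩ := hins.exists_isBlock
      have hlen : V.length < n := by
        rw [← hn, hperm.length_eq, List.length_append, List.length_append, List.length_singleton]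
        omega
      obtain ⟨π, w, hbuild⟩ := ih _ hlen hV (hins.getLast?.symm.trans hlast)
        (fun x hx => hlabel x (hperm.mem_iff.2 (List.mem_append_right _ hx))) rfl
      obtain rfl := Option.some_injective _
        (hins.find?_unmarked_left.symm.trans hbuild.find?_unmarked)
      exact ⟨_, _, hbuild.cons hins⟩

theorem linked_isBottom_iff {R : Row → Row → Prop} {V : List Row} :
    Linked R Row.IsBottom V ↔ Linked R Row.IsGround V ∧ ∀ x ∈ V.getLast?, x.label ≠ 0 := by
  simp only [Linked, Row.IsBottom, forall_and, and_assoc]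

theorem markedStep_sentinel_iff {L : ℕ} {x : Row} (hx : x.label < L) :
    MarkedStep Row.IsVal x (sentinel L) ↔ x.IsGround := by
  unfold MarkedStep Row.Step Row.IsVal Row.IsGround sentinel
  grind

theorem tight_append_sentinel_iff {L : ℕ} {V : List Row} (hV : ∀ x ∈ V, x.label < L) :
    Tight (V ++ [sentinel L]) ↔ Tight V := by
  induction V with
  | nil => simp [Tight, sentinel, attackers]
  | cons y V ih =>
    rw [List.forall_mem_cons] at hV
    have hy : ¬ (sentinel L).Attacks y := by
      simp only [Row.Attacks, sentinel]
      omega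
    have hatt : attackers y (V ++ [sentinel L]) = attackers y V := by simp [attackers, hy]
    rw [List.cons_append, Tight, Tight, ih hV.2, hatt]

theorem tightPF_append_sentinel_iff {L : ℕ} {V : List Row} (hV : ∀ x ∈ V, x.label < L) :
    TightPF (V ++ [sentinel L]) ↔ TightPF V := by
  have hlinked : Linked (MarkedStep Row.IsVal) Row.IsGround (V ++ [sentinel L]) ↔
      Linked (MarkedStep Row.IsVal) Row.IsGround V := by
    rw [linked_append_singleton, and_iff_left ⟨rfl, rfl⟩]
    exact and_congr_right fun _ => forall₂_congr fun x hx =>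
      markedStep_sentinel_iff (hV x (List.mem_of_getLast? hx))
  exact ⟨fun h => ⟨hlinked.1 h.linked, (tight_append_sentinel_iff hV).1 h.tight⟩,
    fun h => ⟨hlinked.2 h.linked, (tight_append_sentinel_iff hV).2 h.tight⟩⟩

theorem IsBlock.zero_mem_iff {L : ℕ} {B : Finset ℕ} {N : List Row} {v : Row}
    (h : IsBlock (sentinel L) B N v) (hB : ∀ x ∈ B, x < L) : 0 ∈ B ↔ v.label = 0 := by
  have hmem (l : ℕ) : l ∈ B ↔ ∃ x ∈ N ++ [v], x.label = l := by
    rw [← Finset.mem_val, ← h.coe_labels, Multiset.mem_coe, List.mem_map]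
  have harea : ∀ x ∈ N ++ [v], x.area = 0 := fun x hx => by
    rw [h.area_eq x hx]
    exact if_neg (hB _ ((hmem _).2 ⟨x, hx, rfl⟩)).not_gt
  refine ⟨fun h0 => ?_, fun hv => (hmem 0).2 ⟨v, by simp, hv⟩⟩
  obtain ⟨x, hx, hx0⟩ := (hmem 0).1 h0
  rcases List.mem_append.1 hx with hxN | hxv
  · have hval : x.IsVal v := (List.pairwise_append.1 h.pairwise).2.2 x hxN v (by simp)
    simp [Row.IsVal, harea x hx, hx0, harea v (by simp)] at hval
  · exact List.mem_singleton.1 hxv ▸ hx0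

theorem Insertion.exists_isBlock_of_singleton {B : Finset ℕ} {s u v : Row} {V : List Row}
    (h : Insertion B u [s] v V) : ∃ N, IsBlock s B N v ∧ V = N ++ [v, s] := by
  obtain ⟨T, T', N, R, hV, rfl, -, -, -, hB⟩ := h
  cases T with
  | cons x T => simp at hV
  | nil =>
    cases T' with
    | cons x T' => simp at hV
    | nil =>
      obtain ⟨rfl, rfl⟩ := List.cons.inj hV
      exact ⟨N, hB, rfl⟩

theorem Build.forall_getLast?_zero_notMem_iff {L : ℕ} {π : List (Finset ℕ)} {u : Row} {V : List Row}
    (h : Build L π u (V ++ [sentinel L])) (hπ : ∀ B ∈ π, ∀ x ∈ B, x < L) :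
    (∀ B, π.getLast? = some B → 0 ∉ B) ↔ ∀ x ∈ V.getLast?, x.label ≠ 0 := by
  generalize hV' : V ++ [sentinel L] = V' at h
  induction h generalizing V with
  | nil =>
    obtain rfl : V = [] := by simpa using hV'
    simp
  | @cons B π u V₀ v V' hbuild hins ih =>
    subst hV'
    rw [List.forall_mem_cons] at hπ
    cases hbuild with
    | nil =>
      obtain ⟨N, hB, hV⟩ := hins.exists_isBlock_of_singleton
      obtain rfl : V = N ++ [v] := List.append_cancel_right (by simpa using hV)
      simp [hB.zero_mem_iff hπ.1]
    | cons hbuild hins' =>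
      have hbuild := hbuild.cons hins'
      obtain ⟨V₁, rfl⟩ := List.getLast?_eq_some_iff.1 hbuild.getLast?
      have hu := hbuild.label_lt (hπ.2 _ (by simp))
      rw [List.getLast?_cons_cons, ih hπ.2 rfl,
        hins.getLast?_of_sentinel fun h => by simp [h, sentinel] at hu]

theorem forall_mem_sum_map_val {π : List (Finset ℕ)} {p : ℕ → Prop} :
    (∀ x ∈ (π.map Finset.val).sum, p x) ↔ ∀ B ∈ π, ∀ x ∈ B, p x := by
  induction π with
  | nil => simp
  | cons B π ih => simp [or_imp, forall_and, ih]

theorem Build.sum_map_val {L : ℕ} {π : List (Finset ℕ)} {u : Row} {V : List Row}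
    (h : Build L π u (V ++ [sentinel L])) :
    (π.map Finset.val).sum = (V.map Row.label : Multiset ℕ) := by
  have hcoe := h.coe_labels
  rw [List.map_append, ← Multiset.coe_add] at hcoe
  exact (add_right_cancel hcoe).symm

theorem mem_markedPF_iff {r : ℕ} {ℓ : ℕ} {β : Fin ℓ → ℕ} {m : ℤ} {V : List Row} :
    V ∈ {V ∈ markedPF Row.IsVal r β m | unmarkedDinv V - numMarks V = 0} ↔
      TightPF V ∧ (∀ x ∈ V.getLast?, x.label ≠ 0) ∧
        (V.map Row.label : Multiset ℕ) = content r β ∧ ((V.length : ℤ) - numMarks V) = m := by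
  rw [markedPF]
  simp only [Set.mem_ofPred_eq, linked_isBottom_iff]
  constructor
  · rintro ⟨⟨⟨hlinked, hlast⟩, hV⟩, hdinv⟩
    exact ⟨⟨hlinked, (unmarkedDinv_sub_numMarks_eq_zero_iff hlinked).1 hdinv⟩, hlast, hV⟩
  · rintro ⟨h, hlast, hV⟩
    exact ⟨⟨⟨h.linked, hlast⟩, hV⟩, (unmarkedDinv_sub_numMarks_eq_zero_iff h.linked).2 h.tight⟩

theorem Build.mem_OP_iff {L r ℓ : ℕ} {β : Fin ℓ → ℕ} {m : ℤ} {π : List (Finset ℕ)} {u : Row}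
    {V : List Row} (h : Build L π u (V ++ [sentinel L])) (hV : ∀ x ∈ V, x.label < L) :
    π ∈ OP r β m ↔
      V ∈ {V ∈ markedPF Row.IsVal r β m | unmarkedDinv V - numMarks V = 0} := by
  have hπ : ∀ B ∈ π, ∀ x ∈ B, x < L := forall_mem_sum_map_val.1 (by simpa [h.sum_map_val] using hV)
  have hlen : (V.length : ℤ) - numMarks V = π.length := by
    have hlen := h.length_eq
    simp only [numMarks, sentinel, List.length_append, List.countP_append, List.length_singleton,
      List.countP_singleton, Bool.false_eq_true, if_false] at hlen ⊢
    omega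
  rw [mem_markedPF_iff, OP, Set.mem_ofPred_eq, h.sum_map_val, hlen,
    h.forall_getLast?_zero_notMem_iff hπ, and_iff_right h.nonempty,
    and_iff_right ((tightPF_append_sentinel_iff hV).1 h.tightPF)]
  tauto

theorem exists_bijOn_build (r : ℕ) {ℓ : ℕ} (β : Fin ℓ → ℕ) (m : ℤ) :
    ∃ Φ : List (Finset ℕ) → List Row,
      Set.BijOn Φ (OP r β m)
        {V ∈ markedPF Row.IsVal r β m | unmarkedDinv V - numMarks V = 0} ∧
      ∀ π ∈ OP r β m, totalArea (Φ π) = minimaj π := by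
  set L := (content r β).sup + 1
  have hL : ∀ x ∈ content r β, x < L := fun x hx => Nat.lt_succ_of_le (Multiset.le_sup hx)
  have hbuild : ∀ π ∈ OP r β m, ∃ V, ∃ u, Build L π u (V ++ [sentinel L]) := fun π hπ => by
    obtain ⟨u, V, h⟩ := exists_build L hπ.1
    obtain ⟨V, rfl⟩ := List.getLast?_eq_some_iff.1 h.getLast?
    exact ⟨V, u, h⟩
  have hlabel {V : List Row} (hV : (V.map Row.label : Multiset ℕ) = content r β) :
      ∀ x ∈ V, x.label < L := fun x hx =>
    hL _ (hV ▸ Multiset.mem_coe.2 (List.mem_map_of_mem hx))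
  choose! Φ hΦ using hbuild
  have hΦlabel : ∀ π ∈ OP r β m, ∀ x ∈ Φ π, x.label < L := fun π hπ => by
    obtain ⟨u, h⟩ := hΦ π hπ
    exact hlabel (h.sum_map_val.symm.trans hπ.2.1)
  refine ⟨Φ, ⟨fun π hπ => ?_, fun π hπ π' hπ' heq => ?_, fun V hV => ?_⟩, fun π hπ => ?_⟩
  · obtain ⟨u, h⟩ := hΦ π hπ
    exact (h.mem_OP_iff (hΦlabel π hπ)).1 hπ
  · obtain ⟨u, h⟩ := hΦ π hπ
    obtain ⟨u', h'⟩ := hΦ π' hπ'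
    exact h.left_unique (heq ▸ h')
  · have hVL := hlabel hV.1.2.1
    have htight := (tightPF_append_sentinel_iff hVL).2 (mem_markedPF_iff.1 hV).1
    obtain ⟨π, u, h⟩ := htight.exists_build (L := L) (by simp)
      (List.forall_mem_append.2 ⟨fun x hx => (hVL x hx).le, by simp [sentinel]⟩)
    have hπ := (h.mem_OP_iff hVL).2 hV
    obtain ⟨u', h'⟩ := hΦ π hπ
    exact ⟨π, hπ, List.append_cancel_right (h'.right_unique h).2⟩
  · obtain ⟨u, h⟩ := hΦ π hπ
    have harea := h.totalArea_eq_minimaj (forall_mem_sum_map_val.1 (hπ.2.1 ▸ hL))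
    simpa [totalArea, sentinel] using harea

theorem aeval_zero_X_valPoly (r : ℕ) {ℓ : ℕ} (β : Fin ℓ → ℕ) (m : ℤ) :
    MvPolynomial.aeval ![0, (Polynomial.X : ℤ[X])] (valPoly r β m) = genPoly r β m minimaj := by
  obtain ⟨Φ, hΦ, hstat⟩ := exists_bijOn_build r β m
  exact aeval_zero_X_markedPoly hΦ hstat

end ExtendedDelta

/-- The coefficients of `x^β` in the two sides are (images in `ℚ(q,t)` of) polynomials in `q, t`;
these are unique, and their values at `t = 0` and at `q = 0` (with `t` renamed `q`) are the
generating polynomials of the four statistics. -/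
theorem mainTheorem5 (n r : ℕ) (k : ℤ) (ℓ : ℕ) (β : Fin ℓ → ℕ) (hβ : ∑ i, β i = n) :
    (∃ P : MvPolynomial (Fin 2) ℤ,
      algebraMap (MvPolynomial (Fin 2) ℤ) ExtendedDelta.Kqt P =
          MvPowerSeries.coeff (ExtendedDelta.monoExp β) (ExtendedDelta.riseSide r n k) ∧
        MvPolynomial.aeval ![(Polynomial.X : ℤ[X]), 0] P =
          ExtendedDelta.genPoly r β (k + r + 1) ExtendedDelta.opDinv ∧
        MvPolynomial.aeval ![0, (Polynomial.X : ℤ[X])] P =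
          ExtendedDelta.genPoly r β (k + r + 1) ExtendedDelta.opMaj) ∧
    (∃ P : MvPolynomial (Fin 2) ℤ,
      algebraMap (MvPolynomial (Fin 2) ℤ) ExtendedDelta.Kqt P =
          MvPowerSeries.coeff (ExtendedDelta.monoExp β) (ExtendedDelta.valSide r n k) ∧
        MvPolynomial.aeval ![(Polynomial.X : ℤ[X]), 0] P =
          ExtendedDelta.genPoly r β (k + r + 1) ExtendedDelta.inv ∧
        MvPolynomial.aeval ![0, (Polynomial.X : ℤ[X])] P =
          ExtendedDelta.genPoly r β (k + r + 1) ExtendedDelta.minimaj) :=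
  ⟨⟨_, ExtendedDelta.algebraMap_risePoly r hβ k, ExtendedDelta.aeval_X_zero_risePoly r β _,
      ExtendedDelta.aeval_zero_X_risePoly r β _⟩,
    ⟨_, ExtendedDelta.algebraMap_valPoly r hβ k, ExtendedDelta.aeval_X_zero_valPoly r β _,
      ExtendedDelta.aeval_zero_X_valPoly r β _⟩⟩
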